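/- Let $\omega_{st}=\frac{i}{2}\sum_{k=1}^{8}dz_k\wedge d\bar z_k$ on $\mathbb{C}^8$ and let $\mathcal{L}:\mathbb{C}^8\to\mathbb{R}^6$, $$\mathcal{L}(z)=-\tfrac12\begin{pmatrix}|z_1|^2+|z_5|^2-6\\ |z_2|^2+|z_5|^2+|z_7|^2-10\\ |z_3|^2+|z_7|^2-6\\ |z_4|^2-|z_5|^2+|z_7|^2-4\\ |z_5|^2-|z_6|^2+|z_7|^2-2\\ |z_5|^2-|z_7|^2+|z_8|^2-4\end{pmatrix},$$ which is the momentum map of the $\mathbb{T}^6$-action on $\mathbb{C}^8$ given by $$\theta\cdot z=(\theta_1z_1,\ \theta_2z_2,\ \theta_3z_3,\ \theta_4z_4,\ \theta_1\theta_2\theta_4^{-1}\theta_5\theta_6z_5,\ \theta_5^{-1}z_6,\ \theta_2\theta_3\theta_4\theta_5\theta_6^{-1}z_7,\ \theta_6z_8).$$ Let $(M,\omega)$ be the symplectic quotient $M=\mathcal{L}^{-1}(0)/\mathbb{T}^6$, a smooth $4$-manifold whose symplectic form $\omega$ is determined by $\tau^*\omega=\kappa^*\omega_{st}$, where $\tau:\mathcal{L}^{-1}(0)\to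 M$ is the quotient map and $\kappa:\mathcal{L}^{-1}(0)\hookrightarrow\mathbb{C}^8$ the inclusion. On $M$ consider the well-defined functions $$J([z])=\tfrac12|z_1|^2,\qquad H([z])=\tfrac12|z_3|^2,\qquad \gamma_1([z])=\tfrac1{50}\operatorname{Re}\bigl(\overline{z_2z_3z_4}\,z_6z_7z_8\bigr),$$ $$\gamma_2([z])=\tfrac1{50}|z_5|^4|z_4|^4,\qquad \gamma_3([z])=\tfrac1{50}|z_4|^4|z_7|^4,\qquad \gamma_4([z])=\tfrac1{100}|z_5|^4|z_7|^4,$$ and, for $t=(t_1,t_2,t_3,t_4)\in\mathbb{R}^4$, $$H_t=(1-2t_1)H+\sum_{j=1}^4t_j\gamma_j.$$ For a smooth function $f:M\to\mathbb{R}$, its Hamiltonian vector field $X^f$ is defined by $\omega(X^f,\cdot)=df$, and the Poisson bracket is $\{f,g\}=\omega(X^f,X^g)$. "Almost everywhere" on $M$ means outside a set whose image in every chart of the atlas has Lebesgue measure zero. Proposition. For every $t\in\mathbb{R}^4$, the Hamiltonian vector fields $X^J$ and $X^{H_t}$ are linearly independent almost everywhere on $M$. Moreover, $(M,\omega,(J,H_t))$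 is a $4$-dimensional completely integrable system: $(M,\omega)$ is a symplectic manifold, $(J,H_t):M\to\mathbb{R}^2$ is smooth, its derivative has rank $2$ almost everywhere, and $\{J,H_t\}=0$. -/

import Mathlib

open scoped Manifold ContDiff

noncomputable section

namespace OctagonSystem

/-! ### The symplectic quotient as a topological space -/

/-- The integer weights of the `𝕋⁶`-action on `ℂ⁸` (row `j` is the `j`-th circle factor). -/
def weight : Matrix (Fin 6) (Fin 8) ℤ :=
  !![1, 0, 0, 0, 1, 0, 0, 0;
     0, 1, 0, 0, 1, 0, 1, 0;
     0, 0, 1, 0, 0, 0, 1, 0;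
     0, 0, 0, 1, -1, 0, 1, 0;
     0, 0, 0, 0, 1, -1, 1, 0;
     0, 0, 0, 0, 1, 0, -1, 1]

/-- The constants in the manifold equations. -/
def level : Fin 6 → ℝ := ![6, 10, 6, 4, 2, 4]

/-- The momentum map `ℒ : ℂ⁸ → ℝ⁶` of the `𝕋⁶`-action. -/
def momentMap (z : Fin 8 → ℂ) : Fin 6 → ℝ :=
  fun j => -(1 / 2) * (∑ k, (weight j k : ℝ) * ‖z k‖ ^ 2 - level j)

/-- The level set `ℒ⁻¹(0) ⊆ ℂ⁸`. -/
abbrev LevelSet : Type := {z : Fin 8 → ℂ // momentMap z = 0}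

/-- The character by which `θ ∈ 𝕋⁶` acts on the `k`-th coordinate of `ℂ⁸`. -/
def torusChar (θ : Fin 6 → Circle) (k : Fin 8) : Circle := ∏ j, θ j ^ weight j k

theorem torusChar_one (k : Fin 8) : torusChar 1 k = 1 := by simp [torusChar]

theorem torusChar_mul (θ η : Fin 6 → Circle) (k : Fin 8) :
    torusChar (θ * η) k = torusChar θ k * torusChar η k := by
  simp [torusChar, mul_zpow, Finset.prod_mul_distrib]

/-- `θ ∈ 𝕋⁶` acts on `ℒ⁻¹(0)` by `z ↦ (χ₁(θ) z₁, …, χ₈(θ) z₈)`. -/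
instance : MulAction (Fin 6 → Circle) LevelSet where
  smul θ z := ⟨fun k => (torusChar θ k : ℂ) * z.1 k, by
    have hn : ∀ k, ‖(torusChar θ k : ℂ) * z.1 k‖ = ‖z.1 k‖ := fun k => by
      rw [norm_mul, Circle.norm_coe, one_mul]
    refine Eq.trans ?_ z.2
    funext j
    simp only [momentMap, hn]⟩
  one_smul z := Subtype.ext (by
    funext k
    change (torusChar 1 k : ℂ) * z.1 k = z.1 k
    simp [torusChar_one])
  mul_smul θ η z := Subtype.ext (by
    funext k
    change (torusChar (θ * η) k : ℂ) * z.1 k = torusChar θ k * (torusChar η k * z.1 k)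
    simp [torusChar_mul, mul_assoc])

theorem smul_val (θ : Fin 6 → Circle) (z : LevelSet) (k : Fin 8) :
    (θ • z).1 k = (torusChar θ k : ℂ) * z.1 k := rfl

/-- The symplectic quotient `M = ℒ⁻¹(0) / 𝕋⁶`, with the quotient topology. -/
def M : Type := MulAction.orbitRel.Quotient (Fin 6 → Circle) LevelSet

instance : TopologicalSpace M :=
  inferInstanceAs (TopologicalSpace (MulAction.orbitRel.Quotient (Fin 6 → Circle) LevelSet))

/-- The quotient map `τ : ℒ⁻¹(0) → M`. -/
def proj (z : LevelSet) : M := Quotient.mk (MulAction.orbitRel (Fin 6 → Circle) LevelSet) z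

theorem proj_surjective : Function.Surjective proj := Quotient.mk_surjective

theorem proj_eq_iff {z w : LevelSet} : proj z = proj w ↔ ∃ θ : Fin 6 → Circle, θ • w = z :=
  Quotient.eq''

theorem continuous_torusChar : Continuous fun θ : Fin 6 → Circle => torusChar θ := by
  unfold torusChar
  fun_prop

theorem continuous_val : Continuous fun z : LevelSet => z.1 := continuous_subtype_val

theorem continuous_act :
    Continuous fun p : (Fin 6 → Circle) × LevelSet => p.1 • p.2 := by
  refine Continuous.subtype_mk (f := fun p : (Fin 6 → Circle) × LevelSet =>
    fun k => (torusChar p.1 k : ℂ) * p.2.1 k) ?_ _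
  refine continuous_pi fun k => ?_
  have h1 : Continuous fun p : (Fin 6 → Circle) × LevelSet => torusChar p.1 k :=
    (continuous_apply k).comp (continuous_torusChar.comp continuous_fst)
  have h2 : Continuous fun p : (Fin 6 → Circle) × LevelSet => p.2.1 k :=
    (continuous_apply k).comp (continuous_val.comp continuous_snd)
  exact (continuous_subtype_val.comp h1).mul h2

instance : ContinuousSMul (Fin 6 → Circle) LevelSet := ⟨continuous_act⟩

theorem isOpenQuotientMap_proj : IsOpenQuotientMap proj :=
  MulAction.isOpenQuotientMap_quotientMk

theorem levelSet_eq (z : LevelSet) (j : Fin 6) :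
    ∑ k, (weight j k : ℝ) * ‖z.1 k‖ ^ 2 = level j := by
  have h := congrFun z.2 j
  simp only [momentMap, Pi.zero_apply] at h
  linarith

theorem isCompact_levelSet : IsCompact {z : Fin 8 → ℂ | momentMap z = 0} := by
  refine Metric.isCompact_of_isClosed_isBounded ?_ ?_
  · refine isClosed_eq ?_ continuous_const
    unfold momentMap
    fun_prop
  · refine (Metric.isBounded_closedBall (x := (0 : Fin 8 → ℂ)) (r := 20)).subset fun z hz => ?_
    have h := levelSet_eq ⟨z, hz⟩
    have h0 := h 0; have h1 := h 1; have h2 := h 2; have h3 := h 3; have h4 := h 4; have h5 := h 5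
    simp [weight, level, Fin.sum_univ_eight] at h0 h1 h2 h3 h4 h5
    rw [mem_closedBall_zero_iff, pi_norm_le_iff_of_nonneg (by norm_num)]
    intro k
    have hk : ‖z k‖ ^ 2 ≤ 20 ^ 2 := by
      have p0 := sq_nonneg ‖z 0‖; have p1 := sq_nonneg ‖z 1‖; have p2 := sq_nonneg ‖z 2‖
      have p3 := sq_nonneg ‖z 3‖; have p4 := sq_nonneg ‖z 4‖; have p5 := sq_nonneg ‖z 5‖
      have p6 := sq_nonneg ‖z 6‖; have p7 := sq_nonneg ‖z 7‖
      fin_cases k <;> simp <;> linarith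
    exact le_of_sq_le_sq hk (by norm_num)

instance : CompactSpace LevelSet := isCompact_iff_compactSpace.1 isCompact_levelSet

instance : CompactSpace M := by
  refine ⟨?_⟩
  rw [← proj_surjective.range_eq]
  exact isCompact_range isOpenQuotientMap_proj.continuous

instance : T2Space M := by
  rw [t2Space_iff_of_isOpenQuotientMap isOpenQuotientMap_proj]
  have h : {q : LevelSet × LevelSet | proj q.1 = proj q.2} =
      Set.range fun p : (Fin 6 → Circle) × LevelSet => (p.1 • p.2, p.2) := by
    ext ⟨z, w⟩
    simp only [Set.mem_ofPred_eq, proj_eq_iff, Set.mem_range, Prod.mk.injEq, Prod.exists]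
    constructor
    · rintro ⟨θ, h⟩
      exact ⟨θ, w, h, rfl⟩
    · rintro ⟨θ, w', h, rfl⟩
      exact ⟨θ, h⟩
  rw [h]
  exact (isCompact_range (continuous_act.prodMk continuous_snd)).isClosed

instance : SecondCountableTopology M :=
  isOpenQuotientMap_proj.isQuotientMap.secondCountableTopology isOpenQuotientMap_proj.isOpenMap

/-! ### The eight coordinate charts -/

/-- The primitive inner normals of the edges of the octagon. -/
def normal : Fin 8 → ℤ × ℤ :=
  ![(1, 0), (1, 1), (0, 1), (-1, 1), (-1, 0), (-1, -1), (0, -1), (1, -1)]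

/-- `normal k = e₁ ν k • normal ν + e₂ ν k • normal (ν + 1)`. -/
def e₁ (ν k : Fin 8) : ℤ :=
  (normal k).1 * (normal (ν + 1)).2 - (normal k).2 * (normal (ν + 1)).1

/-- See `e₁`. -/
def e₂ (ν k : Fin 8) : ℤ :=
  (normal ν).1 * (normal k).2 - (normal ν).2 * (normal k).1

/-- A particular solution of the manifold equations, in terms of the squares `|z_k|²`. -/
def offset : Fin 8 → ℝ := ![0, -2, 0, 4, 6, 10, 6, 4]

/-- The value of `|z_k|²` on `ℒ⁻¹(0)`, as a function of `(z_ν, z_{ν+1}) = (a, b)`. -/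
def radicand (ν k : Fin 8) (q : ℂ × ℂ) : ℝ :=
  offset k + e₁ ν k * (‖q.1‖ ^ 2 - offset ν) + e₂ ν k * (‖q.2‖ ^ 2 - offset (ν + 1))

/-- The parametrization `φ_ν : (a, b) ↦ (z₁, …, z₈)` with `z_ν = a`, `z_{ν+1} = b` and the other
six coordinates positive real. For `ν = 0` this is
`(a, b, √(2-|a|²+|b|²), √(6-2|a|²+|b|²), √(6-|a|²), √(8-|b|²), √(4+|a|²-|b|²), √(2+2|a|²-|b|²))`,
see `radicand_zero`. -/
def sec (ν : Fin 8) (q : ℂ × ℂ) : Fin 8 → ℂ := fun k =>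
  if k = ν then q.1 else if k = ν + 1 then q.2 else (√(radicand ν k q) : ℂ)

/-- The indices `k ∉ {ν, ν + 1}`. -/
def others (ν : Fin 8) : Finset (Fin 8) := {ν, ν + 1}ᶜ

/-- The domain of `φ_ν`: the expressions under the square roots are positive. -/
def dom (ν : Fin 8) : Set (ℂ × ℂ) := {q | ∀ k ∈ others ν, 0 < radicand ν k q}

theorem radicand_zero (q : ℂ × ℂ) : (fun k => radicand 0 k q) =
    ![‖q.1‖ ^ 2, ‖q.2‖ ^ 2, 2 - ‖q.1‖ ^ 2 + ‖q.2‖ ^ 2, 6 - 2 * ‖q.1‖ ^ 2 + ‖q.2‖ ^ 2,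
      6 - ‖q.1‖ ^ 2, 8 - ‖q.2‖ ^ 2, 4 + ‖q.1‖ ^ 2 - ‖q.2‖ ^ 2,
      2 + 2 * ‖q.1‖ ^ 2 - ‖q.2‖ ^ 2] := by
  funext k
  fin_cases k <;> simp [radicand, e₁, e₂, normal, offset] <;> ring

/-- The coordinates of the chart inverse to `φ_ν`, on the points of `ℂ⁸` with `z_k ≠ 0` for
`k ∉ {ν, ν + 1}`: the `ν`-th and `(ν + 1)`-st coordinate after the other six have been rotated to
the positive real axis by the `𝕋⁶`-action. -/
def coord (ν : Fin 8) (z : Fin 8 → ℂ) : ℂ × ℂ :=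
  (z ν * ∏ k ∈ others ν, (z k / ‖z k‖) ^ e₁ ν k,
   z (ν + 1) * ∏ k ∈ others ν, (z k / ‖z k‖) ^ e₂ ν k)

theorem mem_others {ν k : Fin 8} : k ∈ others ν ↔ k ≠ ν ∧ k ≠ ν + 1 := by
  simp [others]

theorem ne_add_one (ν : Fin 8) : ν + 1 ≠ ν := by revert ν; decide

theorem e₁_self (ν : Fin 8) : e₁ ν ν = 1 := by revert ν; decide
theorem e₂_self (ν : Fin 8) : e₂ ν ν = 0 := by revert ν; decide
theorem e₁_succ (ν : Fin 8) : e₁ ν (ν + 1) = 0 := by revert ν; decide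
theorem e₂_succ (ν : Fin 8) : e₂ ν (ν + 1) = 1 := by revert ν; decide

theorem normal_eq (ν k : Fin 8) :
    normal k = e₁ ν k • normal ν + e₂ ν k • normal (ν + 1) := by
  revert ν k; decide

theorem weight_normal (j : Fin 6) : ∑ k, weight j k • normal k = 0 := by
  revert j; decide

theorem weight_e₁ (ν : Fin 8) (j : Fin 6) : ∑ k, weight j k * e₁ ν k = 0 := by
  revert ν j; decide

theorem weight_e₂ (ν : Fin 8) (j : Fin 6) : ∑ k, weight j k * e₂ ν k = 0 := by
  revert ν j; decide

theorem weight_offset (j : Fin 6) : ∑ k, (weight j k : ℝ) * offset k = level j := by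
  fin_cases j <;> simp [weight, offset, level, Fin.sum_univ_eight] <;> norm_num

/-- The kernel of the weight matrix is spanned by `e₁ ν` and `e₂ ν`. -/
theorem eq_of_weight_eq_zero {x : Fin 8 → ℝ} (hx : ∀ j, ∑ k, (weight j k : ℝ) * x k = 0)
    (ν k : Fin 8) : x k = e₁ ν k * x ν + e₂ ν k * x (ν + 1) := by
  have key : ∀ k, x k = (normal k).1 * x 0 + (normal k).2 * x 2 := by
    have h0 := hx 0; have h1 := hx 1; have h2 := hx 2
    have h3 := hx 3; have h4 := hx 4; have h5 := hx 5
    simp [weight, Fin.sum_univ_eight] at h0 h1 h2 h3 h4 h5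
    intro k
    fin_cases k <;> simp [normal] <;> linarith
  have hn := normal_eq ν k
  have hn1 : ((normal k).1 : ℝ) = e₁ ν k * (normal ν).1 + e₂ ν k * (normal (ν + 1)).1 := by
    have := congrArg Prod.fst hn
    simp at this
    exact_mod_cast this
  have hn2 : ((normal k).2 : ℝ) = e₁ ν k * (normal ν).2 + e₂ ν k * (normal (ν + 1)).2 := by
    have := congrArg Prod.snd hn
    simp at this
    exact_mod_cast this
  rw [key k, key ν, key (ν + 1), hn1, hn2]
  ring

theorem normSq_eq_radicand (z : LevelSet) (ν k : Fin 8) :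
    ‖z.1 k‖ ^ 2 = radicand ν k (z.1 ν, z.1 (ν + 1)) := by
  have h := eq_of_weight_eq_zero (x := fun k => ‖z.1 k‖ ^ 2 - offset k) (fun j => by
    simp only [mul_sub, Finset.sum_sub_distrib, levelSet_eq z j, weight_offset, sub_self]) ν k
  simp only [radicand] at h ⊢
  linarith

theorem radicand_congr {q q' : ℂ × ℂ} (h1 : ‖q.1‖ = ‖q'.1‖) (h2 : ‖q.2‖ = ‖q'.2‖) (ν k : Fin 8) :
    radicand ν k q = radicand ν k q' := by
  simp [radicand, h1, h2]

theorem normSq_sec {ν : Fin 8} {q : ℂ × ℂ} (hq : q ∈ dom ν) (k : Fin 8) :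
    ‖sec ν q k‖ ^ 2 = radicand ν k q := by
  by_cases h1 : k = ν
  · subst h1
    simp [sec, radicand, e₁_self, e₂_self]
  · by_cases h2 : k = ν + 1
    · subst h2
      simp [sec, radicand, e₁_succ, e₂_succ]
    · have hk := hq k (mem_others.2 ⟨h1, h2⟩)
      simp only [sec, h1, h2, if_false, Complex.norm_real, Real.norm_eq_abs, sq_abs]
      exact Real.sq_sqrt hk.le

theorem momentMap_sec {ν : Fin 8} {q : ℂ × ℂ} (hq : q ∈ dom ν) : momentMap (sec ν q) = 0 := by
  funext j
  have e1 : ∑ k, (weight j k : ℝ) * e₁ ν k = 0 := by exact_mod_cast weight_e₁ ν j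
  have e2 : ∑ k, (weight j k : ℝ) * e₂ ν k = 0 := by exact_mod_cast weight_e₂ ν j
  have : ∑ k, (weight j k : ℝ) * radicand ν k q = level j := by
    simp only [radicand, mul_add, Finset.sum_add_distrib, weight_offset, ← mul_assoc,
      ← Finset.sum_mul, e1, e2]
    ring
  simp only [momentMap, normSq_sec hq, this, Pi.zero_apply]
  ring

theorem others_prod {G : Type*} [CommMonoid G] (ν : Fin 8) (f : Fin 8 → G) :
    ∏ k, f k = f ν * f (ν + 1) * ∏ k ∈ others ν, f k := by
  rw [others, ← Finset.prod_mul_prod_compl {ν, ν + 1} f,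
    Finset.prod_pair (ne_add_one ν).symm]

theorem others_sum {G : Type*} [AddCommMonoid G] (ν : Fin 8) (f : Fin 8 → G) :
    ∑ k, f k = f ν + f (ν + 1) + ∑ k ∈ others ν, f k := by
  rw [others, ← Finset.sum_add_sum_compl {ν, ν + 1} f,
    Finset.sum_pair (ne_add_one ν).symm]

theorem sec_fst (ν : Fin 8) (q : ℂ × ℂ) : sec ν q ν = q.1 := by simp [sec]

theorem sec_snd (ν : Fin 8) (q : ℂ × ℂ) : sec ν q (ν + 1) = q.2 := by simp [sec]

theorem sec_other {ν k : Fin 8} (hk : k ∈ others ν) (q : ℂ × ℂ) :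
    sec ν q k = (√(radicand ν k q) : ℂ) := by
  have h := mem_others.1 hk
  simp [sec, h.1, h.2]

theorem coord_sec {ν : Fin 8} {q : ℂ × ℂ} (hq : q ∈ dom ν) : coord ν (sec ν q) = q := by
  have h : ∀ k ∈ others ν, sec ν q k / ‖sec ν q k‖ = 1 := fun k hk => by
    have h0 : 0 < √(radicand ν k q) := Real.sqrt_pos.2 (hq k hk)
    rw [sec_other hk, Complex.norm_real, Real.norm_of_nonneg h0.le]
    exact div_self (by exact_mod_cast h0.ne')
  unfold coord
  rw [Finset.prod_eq_one fun k hk => by rw [h k hk, one_zpow],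
    Finset.prod_eq_one fun k hk => by rw [h k hk, one_zpow], sec_fst, sec_snd, mul_one, mul_one]

theorem prod_zpow_eq {G ι : Type*} [CommGroup G] (s : Finset ι) (a : G) (f : ι → ℤ) :
    ∏ i ∈ s, a ^ f i = a ^ ∑ i ∈ s, f i := by
  classical
  induction s using Finset.induction_on with
  | empty => simp
  | insert i s hi ih => rw [Finset.prod_insert hi, Finset.sum_insert hi, ih, zpow_add]

theorem torusChar_prod {e : Fin 8 → ℤ} (he : ∀ j, ∑ k, weight j k * e k = 0)
    (θ : Fin 6 → Circle) : ∏ k, torusChar θ k ^ e k = 1 := by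
  simp only [torusChar, ← Finset.prod_zpow, ← zpow_mul]
  rw [Finset.prod_comm]
  refine Finset.prod_eq_one fun j _ => ?_
  rw [prod_zpow_eq, he j, zpow_zero]

theorem torusChar_e₁ (ν : Fin 8) (θ : Fin 6 → Circle) :
    torusChar θ ν * ∏ k ∈ others ν, torusChar θ k ^ e₁ ν k = 1 := by
  have h := torusChar_prod (weight_e₁ ν) θ
  rw [others_prod ν] at h
  simpa [e₁_self, e₁_succ] using h

theorem torusChar_e₂ (ν : Fin 8) (θ : Fin 6 → Circle) :
    torusChar θ (ν + 1) * ∏ k ∈ others ν, torusChar θ k ^ e₂ ν k = 1 := by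
  have h := torusChar_prod (weight_e₂ ν) θ
  rw [others_prod ν] at h
  simpa [e₂_self, e₂_succ] using h

/-- An element of `𝕋⁸` is in the image of `𝕋⁶` if it satisfies the two dual equations. -/
theorem exists_torusChar {η : Fin 8 → Circle} (h1 : ∏ k, η k ^ (normal k).1 = 1)
    (h2 : ∏ k, η k ^ (normal k).2 = 1) : ∃ θ, torusChar θ = η := by
  refine ⟨![η 0, η 1, η 2, η 3, (η 5)⁻¹, η 7], ?_⟩
  simp [normal, Fin.prod_univ_eight] at h1 h2
  have h4 : η 4 = η 0 * η 1 * (η 3)⁻¹ * (η 5)⁻¹ * η 7 := by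
    refine (eq_of_mul_inv_eq_one (Eq.trans ?_ h1)).symm
    simp only [mul_comm, mul_left_comm, mul_assoc]
  have h6 : η 6 = η 1 * η 2 * η 3 * (η 5)⁻¹ * (η 7)⁻¹ := by
    refine (eq_of_mul_inv_eq_one (Eq.trans ?_ h2)).symm
    simp only [mul_comm, mul_left_comm, mul_assoc]
  funext k
  fin_cases k <;> simp [torusChar, weight, Fin.prod_univ_six, h4, h6]

theorem coord_act (ν : Fin 8) (θ : Fin 6 → Circle) (z : Fin 8 → ℂ) :
    coord ν (fun k => torusChar θ k * z k) = coord ν z := by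
  have h : ∀ k, (torusChar θ k * z k) / ‖(torusChar θ k * z k : ℂ)‖ =
      torusChar θ k * (z k / ‖z k‖) := fun k => by
    rw [norm_mul, Circle.norm_coe, one_mul, mul_div_assoc]
  have c1 : (torusChar θ ν : ℂ) * ∏ k ∈ others ν, (torusChar θ k : ℂ) ^ e₁ ν k = 1 := by
    have := congrArg Circle.coeHom (torusChar_e₁ ν θ)
    simp at this
    exact this
  have c2 : (torusChar θ (ν + 1) : ℂ) * ∏ k ∈ others ν, (torusChar θ k : ℂ) ^ e₂ ν k = 1 := by
    have := congrArg Circle.coeHom (torusChar_e₂ ν θ)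
    simp at this
    exact this
  unfold coord
  simp only [h, mul_zpow, Finset.prod_mul_distrib]
  ext1
  · dsimp only
    linear_combination (z ν * ∏ k ∈ others ν, (z k / ‖z k‖) ^ e₁ ν k) * c1
  · dsimp only
    linear_combination (z (ν + 1) * ∏ k ∈ others ν, (z k / ‖z k‖) ^ e₂ ν k) * c2

theorem exists_phase (w : ℂ) : ∃ c : Circle, w ≠ 0 → (c : ℂ) = w / ‖w‖ := by
  by_cases hw : w = 0
  · exact ⟨1, fun h => absurd hw h⟩
  · refine ⟨⟨w / ‖w‖, ?_⟩, fun _ => rfl⟩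
    rw [Submonoid.unitSphere, ← SetLike.mem_coe]
    change _ ∈ Metric.sphere (0 : ℂ) 1
    rw [mem_sphere_zero_iff_norm, norm_div, Complex.norm_real, norm_norm, div_self (norm_ne_zero_iff.2 hw)]

theorem prod_normal_eq {G : Type*} [CommGroup G] (ν : Fin 8) (p : Fin 8 → G)
    (n e e' : Fin 8 → ℤ) (hn : ∀ k, n k = e k * n ν + e' k * n (ν + 1)) :
    ∏ k, (if k = ν then ∏ i ∈ others ν, p i ^ e i else
      if k = ν + 1 then ∏ i ∈ others ν, p i ^ e' i else (p k)⁻¹) ^ n k = 1 := by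
  rw [others_prod ν]
  have h : ∀ k ∈ others ν, (if k = ν then ∏ i ∈ others ν, p i ^ e i else
      if k = ν + 1 then ∏ i ∈ others ν, p i ^ e' i else (p k)⁻¹) ^ n k =
      ((p k ^ e k) ^ n ν * (p k ^ e' k) ^ n (ν + 1))⁻¹ := fun k hk => by
    have hk := mem_others.1 hk
    rw [if_neg hk.1, if_neg hk.2, inv_zpow, ← zpow_mul, ← zpow_mul, ← zpow_add, ← hn]
  rw [Finset.prod_congr rfl h]
  simp only [if_true, if_neg (ne_add_one ν), Finset.prod_inv_distrib, Finset.prod_mul_distrib,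
    Finset.prod_zpow, mul_inv_cancel]

/-- A point of the level set can be rotated into the image of `φ_ν`. -/
theorem exists_act_eq_sec (ν : Fin 8) (z : LevelSet) (hz : ∀ k ∈ others ν, z.1 k ≠ 0) :
    ∃ θ : Fin 6 → Circle, ∀ k, (torusChar θ k : ℂ) * z.1 k = sec ν (coord ν z.1) k := by
  choose p hp using fun k => exists_phase (z.1 k)
  have hn := normal_eq ν
  obtain ⟨θ, hθ⟩ := exists_torusChar
    (prod_normal_eq ν p (fun k => (normal k).1) (e₁ ν) (e₂ ν) (fun k => by
      have := congrArg Prod.fst (hn k)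
      simpa using this))
    (prod_normal_eq ν p (fun k => (normal k).2) (e₁ ν) (e₂ ν) (fun k => by
      have := congrArg Prod.snd (hn k)
      simpa using this))
  refine ⟨θ, fun k => ?_⟩
  have hprod : ∀ e : Fin 8 → ℤ, ((∏ i ∈ others ν, p i ^ e i : Circle) : ℂ) =
      ∏ i ∈ others ν, (z.1 i / ‖z.1 i‖) ^ e i := fun e => by
    have h1 : ((∏ i ∈ others ν, p i ^ e i : Circle) : ℂ) = ∏ i ∈ others ν, (p i : ℂ) ^ e i := by
      exact map_prod Circle.coeHom (fun i => p i ^ e i) (others ν)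
    rw [h1]
    exact Finset.prod_congr rfl fun i hi => by rw [hp i (hz i hi)]
  have hnorm : ∀ e : Fin 8 → ℤ, ‖∏ i ∈ others ν, (z.1 i / ‖z.1 i‖) ^ e i‖ = 1 := fun e => by
    rw [← hprod, Circle.norm_coe]
  have hk := congrFun hθ k
  by_cases h1 : k = ν
  · subst h1
    rw [if_pos rfl] at hk
    rw [sec_fst, hk, hprod, mul_comm]
    rfl
  · by_cases h2 : k = ν + 1
    · subst h2
      rw [if_neg h1, if_pos rfl] at hk
      rw [sec_snd, hk, hprod, mul_comm]
      rfl
    · rw [if_neg h1, if_neg h2] at hk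
      have hη := hk
      have hk := mem_others.2 ⟨h1, h2⟩
      have h0 : (‖z.1 k‖ : ℂ) ≠ 0 := by
        exact_mod_cast norm_ne_zero_iff.2 (hz k hk)
      rw [sec_other hk, hη, Circle.coe_inv, hp k (hz k hk),
        radicand_congr (q' := (z.1 ν, z.1 (ν + 1))) (by simp [coord, hnorm])
          (by simp [coord, hnorm]), ← normSq_eq_radicand,
        Real.sqrt_sq (norm_nonneg _), inv_div, div_mul_cancel₀ _ (hz k hk)]

theorem coord_mem_dom (ν : Fin 8) (z : LevelSet) (hz : ∀ k ∈ others ν, z.1 k ≠ 0) :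
    coord ν z.1 ∈ dom ν := by
  obtain ⟨θ, hθ⟩ := exists_act_eq_sec ν z hz
  have h1 : ‖(coord ν z.1).1‖ = ‖z.1 ν‖ := by
    rw [← sec_fst ν (coord ν z.1), ← hθ, norm_mul, Circle.norm_coe, one_mul]
  have h2 : ‖(coord ν z.1).2‖ = ‖z.1 (ν + 1)‖ := by
    rw [← sec_snd ν (coord ν z.1), ← hθ, norm_mul, Circle.norm_coe, one_mul]
  intro k hk
  rw [radicand_congr (q' := (z.1 ν, z.1 (ν + 1))) h1 h2, ← normSq_eq_radicand]
  have := norm_pos_iff.2 (hz k hk)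
  positivity

theorem sec_ne_zero {ν : Fin 8} {q : ℂ × ℂ} (hq : q ∈ dom ν) {k : Fin 8} (hk : k ∈ others ν) :
    sec ν q k ≠ 0 := by
  have h := normSq_sec hq k
  intro h0
  rw [h0] at h
  have := hq k hk
  simp at h
  linarith

theorem isOpen_dom (ν : Fin 8) : IsOpen (dom ν) := by
  have : dom ν = ⋂ k ∈ others ν, {q | 0 < radicand ν k q} := by
    ext q
    simp [dom]
  rw [this]
  refine isOpen_biInter_finset fun k _ => isOpen_lt continuous_const ?_
  unfold radicand
  fun_prop

/-- `U_ν ⊆ M`: the points `[z]` with `z_k ≠ 0` for all `k ∉ {ν, ν + 1}`. -/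
def chartDomain (ν : Fin 8) : Set M := {p | ∃ z, proj z = p ∧ ∀ k ∈ others ν, z.1 k ≠ 0}

/-- The chart `U_ν → ℂ²` on `M`. -/
def chartMap (ν : Fin 8) : M → ℂ × ℂ :=
  Quotient.lift (fun z : LevelSet => coord ν z.1) (by
    rintro z w ⟨θ, rfl⟩
    exact coord_act ν θ w.1)

theorem chartMap_proj (ν : Fin 8) (z : LevelSet) : chartMap ν (proj z) = coord ν z.1 := rfl

theorem proj_mem_chartDomain {ν : Fin 8} {z : LevelSet} :
    proj z ∈ chartDomain ν ↔ ∀ k ∈ others ν, z.1 k ≠ 0 := by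
  refine ⟨?_, fun h => ⟨z, rfl, h⟩⟩
  rintro ⟨w, hw, h⟩ k hk h0
  obtain ⟨θ, rfl⟩ := proj_eq_iff.1 hw
  refine h k hk ?_
  rw [smul_val, h0, mul_zero]

theorem isOpen_chartDomain (ν : Fin 8) : IsOpen (chartDomain ν) := by
  rw [← isOpenQuotientMap_proj.isQuotientMap.isOpen_preimage]
  have : proj ⁻¹' chartDomain ν = ⋂ k ∈ others ν, {z | z.1 k ≠ 0} := by
    ext z
    simp [proj_mem_chartDomain]
  rw [this]
  exact isOpen_biInter_finset fun k _ =>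
    isOpen_ne_fun ((continuous_apply k).comp continuous_val) continuous_const

/-- The map `ℂ² → M` induced by `φ_ν` (with a junk value outside the domain). -/
def param (ν : Fin 8) (q : ℂ × ℂ) : M :=
  open Classical in
  proj (if h : momentMap (sec ν q) = 0 then ⟨sec ν q, h⟩ else ⟨sec 0 (1, 1), momentMap_sec (by
    intro k hk
    have := congrFun (radicand_zero (1, 1)) k
    dsimp only at this
    rw [this]
    revert hk
    fin_cases k <;> norm_num [others])⟩)

theorem param_eq {ν : Fin 8} {q : ℂ × ℂ} (hq : q ∈ dom ν) :
    param ν q = proj ⟨sec ν q, momentMap_sec hq⟩ := by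
  unfold param
  rw [dif_pos (momentMap_sec hq)]

theorem contDiffAt_sec {ν : Fin 8} {q : ℂ × ℂ} (hq : q ∈ dom ν) :
    ContDiffAt ℝ ∞ (sec ν) q := by
  rw [contDiffAt_pi]
  intro k
  unfold sec
  by_cases h1 : k = ν
  · simp only [h1, if_true]
    exact contDiffAt_fst
  · by_cases h2 : k = ν + 1
    · simp only [h2, if_true, if_false, ne_add_one]
      exact contDiffAt_snd
    · simp only [h1, h2, if_false]
      have hr : ContDiffAt ℝ ∞ (radicand ν k) q := by
        unfold radicand
        have ha : ContDiff ℝ ∞ fun q : ℂ × ℂ => ‖q.1‖ ^ 2 := contDiff_fst.norm_sq ℝ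
        have hb : ContDiff ℝ ∞ fun q : ℂ × ℂ => ‖q.2‖ ^ 2 := contDiff_snd.norm_sq ℝ
        fun_prop
      exact (Complex.ofRealCLM.contDiff.contDiffAt).comp q
        (hr.sqrt (hq k (mem_others.2 ⟨h1, h2⟩)).ne')

theorem contDiffAt_phase {w : ℂ} (hw : w ≠ 0) (n : ℤ) :
    ContDiffAt ℝ ∞ (fun w : ℂ => (w / ‖w‖) ^ n) w := by
  have h0 : (‖w‖ : ℂ) ≠ 0 := by exact_mod_cast norm_ne_zero_iff.2 hw
  have h1 : ContDiffAt ℝ ∞ (fun w : ℂ => w / (‖w‖ : ℂ)) w := by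
    simp only [div_eq_mul_inv]
    have h2 : ContDiffAt ℝ ∞ (fun w : ℂ => (‖w‖ : ℂ)) w :=
      (Complex.ofRealCLM.contDiff.contDiffAt).comp w (contDiffAt_norm ℝ hw)
    exact contDiffAt_id.mul (h2.inv h0)
  obtain ⟨m, rfl | rfl⟩ := n.eq_nat_or_neg
  · simpa only [zpow_natCast] using h1.pow m
  · simp only [zpow_neg, zpow_natCast]
    exact (h1.pow m).inv (pow_ne_zero _ (div_ne_zero hw h0))

theorem contDiffAt_coord {ν : Fin 8} {z : Fin 8 → ℂ} (hz : ∀ k ∈ others ν, z k ≠ 0) :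
    ContDiffAt ℝ ∞ (coord ν) z := by
  have hk : ∀ k, ContDiffAt ℝ ∞ (fun z : Fin 8 → ℂ => z k) z := fun k =>
    (contDiff_apply ℝ ℂ k).contDiffAt
  have hp : ∀ e : Fin 8 → ℤ, ContDiffAt ℝ ∞
      (fun z : Fin 8 → ℂ => ∏ k ∈ others ν, (z k / ‖z k‖) ^ e k) z := fun e =>
    contDiffAt_prod fun k hk' => by
      have := ContDiffAt.comp (g := fun w : ℂ => (w / ‖w‖) ^ e k) z
        (contDiffAt_phase (hz k hk') (e k)) (hk k)
      exact this
  exact ((hk ν).mul (hp _)).prodMk ((hk (ν + 1)).mul (hp _))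

theorem param_mem {ν : Fin 8} {q : ℂ × ℂ} (hq : q ∈ dom ν) : param ν q ∈ chartDomain ν := by
  rw [param_eq hq, proj_mem_chartDomain]
  exact fun k hk => sec_ne_zero hq hk

theorem param_chartMap {ν : Fin 8} {p : M} (hp : p ∈ chartDomain ν) :
    param ν (chartMap ν p) = p := by
  obtain ⟨z, rfl⟩ := proj_surjective p
  have hz := proj_mem_chartDomain.1 hp
  rw [chartMap_proj, param_eq (coord_mem_dom ν z hz), proj_eq_iff]
  obtain ⟨θ, hθ⟩ := exists_act_eq_sec ν z hz
  exact ⟨θ, Subtype.ext (funext hθ)⟩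

/-- The chart `(U_ν, φ_ν⁻¹)` of `M`. -/
def chart (ν : Fin 8) : OpenPartialHomeomorph M (ℂ × ℂ) where
  toFun := chartMap ν
  invFun := param ν
  source := chartDomain ν
  target := dom ν
  map_source' p hp := by
    obtain ⟨z, rfl⟩ := proj_surjective p
    exact coord_mem_dom ν z (proj_mem_chartDomain.1 hp)
  map_target' q hq := param_mem hq
  left_inv' p hp := param_chartMap hp
  right_inv' q hq := by
    rw [param_eq hq, chartMap_proj]
    exact coord_sec hq
  open_source := isOpen_chartDomain ν
  open_target := isOpen_dom ν
  continuousOn_toFun := by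
    rw [isOpenQuotientMap_proj.isQuotientMap.continuousOn_isOpen_iff (isOpen_chartDomain ν)]
    intro z hz
    have h := (contDiffAt_coord (proj_mem_chartDomain.1 hz)).continuousAt
    exact (h.comp (f := fun z : LevelSet => z.1) continuous_val.continuousAt).continuousWithinAt
  continuousOn_invFun := by
    rw [continuousOn_iff_continuous_domRestrict]
    have h : (dom ν).domRestrict (param ν) =
        fun q : dom ν => proj ⟨sec ν q.1, momentMap_sec q.2⟩ := by
      funext q
      exact param_eq q.2
    rw [h]
    refine isOpenQuotientMap_proj.continuous.comp (Continuous.subtype_mk ?_ _)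
    rw [continuous_iff_continuousAt]
    exact fun q => (contDiffAt_sec q.2).continuousAt.comp continuous_subtype_val.continuousAt

/-- The charts cover `M`. -/
theorem exists_mem_chartDomain (p : M) : ∃ ν, p ∈ chartDomain ν := by
  obtain ⟨z, rfl⟩ := proj_surjective p
  simp only [proj_mem_chartDomain]
  have h := levelSet_eq z
  have h0 := h 0; have h1 := h 1; have h2 := h 2; have h3 := h 3; have h4 := h 4; have h5 := h 5
  simp [weight, level, Fin.sum_univ_eight] at h0 h1 h2 h3 h4 h5
  have hz : ∀ k, z.1 k = 0 → ‖z.1 k‖ ^ 2 = 0 := fun k hk => by simp [hk]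
  have p0 := sq_nonneg ‖z.1 0‖; have p1 := sq_nonneg ‖z.1 1‖; have p2 := sq_nonneg ‖z.1 2‖
  have p3 := sq_nonneg ‖z.1 3‖; have p4 := sq_nonneg ‖z.1 4‖; have p5 := sq_nonneg ‖z.1 5‖
  have p6 := sq_nonneg ‖z.1 6‖; have p7 := sq_nonneg ‖z.1 7‖
  have key : ∀ i j : Fin 8, j ≠ i → j ≠ i + 1 → i ≠ j + 1 → z.1 i = 0 → z.1 j ≠ 0 := by
    intro i j n1 n2 n3 hi hj
    have hi := hz i hi
    have hj := hz j hj
    fin_cases i <;> fin_cases j <;> simp at n1 n2 n3 hi hj <;>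
      simp only [hi, hj, norm_zero] at h0 h1 h2 h3 h4 h5 p0 p1 p2 p3 p4 p5 p6 p7 <;> linarith
  by_cases hall : ∀ i, z.1 i ≠ 0
  · exact ⟨0, fun k _ => hall k⟩
  · push Not at hall
    obtain ⟨i, hi⟩ := hall
    by_cases hs : z.1 (i + 1) = 0
    · refine ⟨i, fun k hk => ?_⟩
      have hk := mem_others.1 hk
      by_cases hk2 : i = k + 1
      · subst hk2
        refine key (k + 1 + 1) k ?_ ?_ ?_ hs <;> clear hs hi hk <;> (try clear hk) <;>
          revert k <;> decide
      · exact key i k hk.1 hk.2 hk2 hi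
    · refine ⟨i - 1, fun k hk => ?_⟩
      have hk := mem_others.1 hk
      rw [sub_add_cancel] at hk
      by_cases hk2 : k = i + 1
      · rw [hk2]; exact hs
      · refine key i k hk.2 hk2 (fun h => hk.1 ?_) hi
        rw [h, add_sub_cancel_right]

/-- The index of the preferred chart at a point. -/
def idx (p : M) : Fin 8 := (exists_mem_chartDomain p).choose

theorem mem_chartDomain_idx (p : M) : p ∈ chartDomain (idx p) :=
  (exists_mem_chartDomain p).choose_spec

instance : ChartedSpace (ℂ × ℂ) M where
  atlas := Set.range chart
  chartAt p := chart (idx p)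
  mem_chart_source p := mem_chartDomain_idx p
  chart_mem_atlas _ := ⟨_, rfl⟩

theorem chartAt_eq (p : M) : chartAt (ℂ × ℂ) p = chart (idx p) := rfl

theorem mem_atlas_iff {e : OpenPartialHomeomorph M (ℂ × ℂ)} :
    e ∈ atlas (ℂ × ℂ) M ↔ ∃ ν, chart ν = e := Iff.rfl

theorem chart_symm_trans {μ ν : Fin 8} {q : ℂ × ℂ} (hq : q ∈ dom ν) :
    chart μ ((chart ν).symm q) = coord μ (sec ν q) := by
  change chartMap μ (param ν q) = _
  rw [param_eq hq]
  rfl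

theorem chart_symm_mem {μ ν : Fin 8} {q : ℂ × ℂ} (hq : q ∈ dom ν) :
    (chart ν).symm q ∈ (chart μ).source ↔ ∀ k ∈ others μ, sec ν q k ≠ 0 := by
  change param ν q ∈ chartDomain μ ↔ _
  rw [param_eq hq, proj_mem_chartDomain]

/-- `M` is a smooth manifold, modelled on `ℂ² = ℝ⁴`. -/
instance : IsManifold 𝓘(ℝ, ℂ × ℂ) ∞ M := by
  refine isManifold_of_contDiffOn _ _ _ ?_
  rintro _ _ ⟨ν, rfl⟩ ⟨μ, rfl⟩
  intro q hq
  have hq : q ∈ ((chart ν).symm ≫ₕ chart μ).source := by simpa using hq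
  rw [OpenPartialHomeomorph.trans_source] at hq
  have hq1 : q ∈ dom ν := hq.1
  have hq2 := (chart_symm_mem hq1).1 hq.2
  have hc : ContDiffAt ℝ ∞ (coord μ ∘ sec ν) q :=
    (contDiffAt_coord hq2).comp q (contDiffAt_sec hq1)
  refine (hc.congr_of_eventuallyEq ?_).contDiffWithinAt
  filter_upwards [(isOpen_dom ν).mem_nhds hq1] with q' hq'
  exact chart_symm_trans hq'

/-! ### Symplectic forms and integrable systems on 4-manifolds -/

section General

variable {X : Type*} [TopologicalSpace X] [ChartedSpace (ℂ × ℂ) X]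

/-- A (not necessarily smooth) differential 2-form on `X`. -/
abbrev TwoForm (X : Type*) [TopologicalSpace X] [ChartedSpace (ℂ × ℂ) X] : Type _ :=
  ∀ p : X, TangentSpace 𝓘(ℝ, ℂ × ℂ) p [⋀^Fin 2]→L[ℝ] ℝ

/-- The coordinate expression `(e⁻¹)^* Ω` of a 2-form in a chart `e`. -/
def formInChart (Ω : TwoForm X) (e : OpenPartialHomeomorph X (ℂ × ℂ)) (q : ℂ × ℂ) :
    (ℂ × ℂ) [⋀^Fin 2]→L[ℝ] ℝ :=
  (Ω (e.symm q)).compContinuousLinearMap (mfderiv 𝓘(ℝ, ℂ × ℂ) 𝓘(ℝ, ℂ × ℂ) e.symm q)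

theorem formInChart_apply (Ω : TwoForm X) (e : OpenPartialHomeomorph X (ℂ × ℂ)) (q : ℂ × ℂ)
    (v : Fin 2 → ℂ × ℂ) : formInChart Ω e q v =
      Ω (e.symm q) fun i => mfderiv 𝓘(ℝ, ℂ × ℂ) 𝓘(ℝ, ℂ × ℂ) e.symm q (v i) := rfl

/-- `Ω` is a symplectic form: smooth, closed and nondegenerate. -/
structure IsSymplectic (Ω : TwoForm X) : Prop where
  smooth : ∀ e ∈ atlas (ℂ × ℂ) X, ContDiffOn ℝ ∞ (formInChart Ω e) e.target
  closed : ∀ e ∈ atlas (ℂ × ℂ) X, ∀ q ∈ e.target, extDeriv (formInChart Ω e) q = 0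
  nondegenerate : ∀ (p : X) (v : TangentSpace 𝓘(ℝ, ℂ × ℂ) p), (∀ w, Ω p ![v, w] = 0) → v = 0

/-- The differential `df` of a real function. -/
def differential (f : X → ℝ) (p : X) : TangentSpace 𝓘(ℝ, ℂ × ℂ) p →L[ℝ] ℝ :=
  mfderiv 𝓘(ℝ, ℂ × ℂ) 𝓘(ℝ, ℝ) f p

/-- The Hamiltonian vector field `X^f`, determined by `Ω(X^f, ·) = df`. -/
def hamVF (Ω : TwoForm X) (f : X → ℝ) (p : X) : TangentSpace 𝓘(ℝ, ℂ × ℂ) p :=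
  Classical.epsilon fun v => ∀ w, Ω p ![v, w] = differential f p w

theorem pair_add_left {V : Type*} [AddCommGroup V] [Module ℝ V] [TopologicalSpace V]
    (Ω : V [⋀^Fin 2]→L[ℝ] ℝ) (v v' w : V) : Ω ![v + v', w] = Ω ![v, w] + Ω ![v', w] := by
  have := Ω.map_update_add ![v, w] 0 v v'
  rwa [show Function.update ![v, w] 0 (v + v') = ![v + v', w] by
      funext i; fin_cases i <;> rfl,
    show Function.update ![v, w] 0 v = ![v, w] by
      funext i; fin_cases i <;> rfl,
    show Function.update ![v, w] 0 v' = ![v', w] by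
      funext i; fin_cases i <;> rfl] at this

theorem pair_smul_left {V : Type*} [AddCommGroup V] [Module ℝ V] [TopologicalSpace V]
    (Ω : V [⋀^Fin 2]→L[ℝ] ℝ) (c : ℝ) (v w : V) : Ω ![c • v, w] = c • Ω ![v, w] := by
  have := Ω.map_update_smul ![v, w] 0 c v
  rwa [show Function.update ![v, w] 0 (c • v) = ![c • v, w] by
      funext i; fin_cases i <;> rfl,
    show Function.update ![v, w] 0 v = ![v, w] by
      funext i; fin_cases i <;> rfl] at this

theorem pair_add_right {V : Type*} [AddCommGroup V] [Module ℝ V] [TopologicalSpace V]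
    (Ω : V [⋀^Fin 2]→L[ℝ] ℝ) (v w w' : V) : Ω ![v, w + w'] = Ω ![v, w] + Ω ![v, w'] := by
  have := Ω.map_update_add ![v, w] 1 w w'
  rwa [show Function.update ![v, w] 1 (w + w') = ![v, w + w'] by
      funext i; fin_cases i <;> rfl,
    show Function.update ![v, w] 1 w = ![v, w] by
      funext i; fin_cases i <;> rfl,
    show Function.update ![v, w] 1 w' = ![v, w'] by
      funext i; fin_cases i <;> rfl] at this

theorem pair_smul_right {V : Type*} [AddCommGroup V] [Module ℝ V] [TopologicalSpace V]
    (Ω : V [⋀^Fin 2]→L[ℝ] ℝ) (c : ℝ) (v w : V) : Ω ![v, c • w] = c • Ω ![v, w] := by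
  have := Ω.map_update_smul ![v, w] 1 c w
  rwa [show Function.update ![v, w] 1 (c • w) = ![v, c • w] by
      funext i; fin_cases i <;> rfl,
    show Function.update ![v, w] 1 w = ![v, w] by
      funext i; fin_cases i <;> rfl] at this

/-- For a nondegenerate form the Hamiltonian vector field exists. -/
theorem hamVF_spec {Ω : TwoForm X} {p : X}
    (h : ∀ v : TangentSpace 𝓘(ℝ, ℂ × ℂ) p, (∀ w, Ω p ![v, w] = 0) → v = 0) (f : X → ℝ)
    (w : TangentSpace 𝓘(ℝ, ℂ × ℂ) p) : Ω p ![hamVF Ω f p, w] = differential f p w := by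
  have hfin : FiniteDimensional ℝ (TangentSpace 𝓘(ℝ, ℂ × ℂ) p) :=
    inferInstanceAs (FiniteDimensional ℝ (ℂ × ℂ))
  let B : TangentSpace 𝓘(ℝ, ℂ × ℂ) p →ₗ[ℝ] Module.Dual ℝ (TangentSpace 𝓘(ℝ, ℂ × ℂ) p) :=
    LinearMap.mk₂ ℝ (fun v w => Ω p ![v, w])
      (fun v v' w => pair_add_left (Ω p) v v' w)
      (fun c v w => pair_smul_left (Ω p) c v w)
      (fun v w w' => pair_add_right (Ω p) v w w')
      (fun c v w => pair_smul_right (Ω p) c v w)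
  have hinj : Function.Injective B := by
    rw [injective_iff_map_eq_zero]
    exact fun v hv => h v fun w => LinearMap.congr_fun hv w
  have hsurj : Function.Surjective B :=
    (LinearMap.injective_iff_surjective_of_finrank_eq_finrank
      Subspace.dual_finrank_eq.symm).1 hinj
  obtain ⟨v, hv⟩ := hsurj (differential f p : TangentSpace 𝓘(ℝ, ℂ × ℂ) p →ₗ[ℝ] ℝ)
  exact Classical.epsilon_spec
    (p := fun v => ∀ w, Ω p ![v, w] = differential f p w) ⟨v, fun w => LinearMap.congr_fun hv w⟩ w

/-- The Poisson bracket `{f, g} = Ω(X^f, X^g)`. -/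
def poissonBracket (Ω : TwoForm X) (f g : X → ℝ) (p : X) : ℝ :=
  Ω p ![hamVF Ω f p, hamVF Ω g p]

/-- `P` holds almost everywhere on the manifold `X`: in every chart of the atlas, the points
violating `P` form a set of Lebesgue measure zero. -/
def AlmostEverywhere (P : X → Prop) : Prop :=
  ∀ e ∈ atlas (ℂ × ℂ) X, MeasureTheory.volume {q : ℂ × ℂ | q ∈ e.target ∧ ¬ P (e.symm q)} = 0

/-- `(X, Ω, (f, g))` is a 4-dimensional completely integrable system. -/
structure IsCompletelyIntegrable [T2Space X] [SecondCountableTopology X]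
    [IsManifold 𝓘(ℝ, ℂ × ℂ) ∞ X] (Ω : TwoForm X) (f g : X → ℝ) : Prop where
  symplectic : IsSymplectic Ω
  smooth : ContMDiff 𝓘(ℝ, ℂ × ℂ) 𝓘(ℝ, ℝ × ℝ) ∞ fun p => (f p, g p)
  rank_eq_two : AlmostEverywhere fun p : X => Module.finrank ℝ
    (mfderiv 𝓘(ℝ, ℂ × ℂ) 𝓘(ℝ, ℝ × ℝ) (fun p => (f p, g p)) p).toLinearMap.range = 2
  commute : ∀ p, poissonBracket Ω f g p = 0

end General

/-! ### The reduced symplectic form -/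

/-- The standard symplectic form `(i/2) ∑ dz_k ∧ dz̄_k = ∑ dx_k ∧ dy_k` on `ℂ⁸`. -/
def omegaStd : (Fin 8 → ℂ) [⋀^Fin 2]→L[ℝ] ℝ where
  toFun v := ∑ k, ((v 0 k).re * (v 1 k).im - (v 0 k).im * (v 1 k).re)
  map_update_add' v i x y := by
    rw [← Finset.sum_add_distrib]
    refine Finset.sum_congr rfl fun k _ => ?_
    fin_cases i <;> simp <;> ring
  map_update_smul' v i c x := by
    rw [Finset.smul_sum]
    refine Finset.sum_congr rfl fun k _ => ?_
    fin_cases i <;> simp <;> ring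
  map_eq_zero_of_eq' v i j h hij := by
    refine Finset.sum_eq_zero fun k _ => ?_
    have : v 0 = v 1 := by
      fin_cases i <;> fin_cases j <;> simp at hij h
      · exact h
      · exact h.symm
    rw [this]
    ring
  cont := by fun_prop

theorem omegaStd_apply (v w : Fin 8 → ℂ) :
    omegaStd ![v, w] = ∑ k, ((v k).re * (w k).im - (v k).im * (w k).re) := rfl

/-- The reduced form on `M`. It is defined by `τ^* ω = κ^* ω_st`, i.e. `ω(u, u') = ω_st(v, v')` for
lifts `v, v' ∈ ker dℒ` of `u, u' ∈ T_p M`; here the lifts are taken along the local section `φ_ν`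
of `τ` on the preferred chart. See `reducedForm_pullback` for arbitrary lifts. -/
def reducedForm : TwoForm M := fun p =>
  omegaStd.compContinuousLinearMap (fderiv ℝ (sec (idx p)) (chartMap (idx p) p))

/-- The differential `dτ_z` of the quotient map `τ : ℒ⁻¹(0) → M`, in the preferred chart at
`τ(z)`; it is meant on `T_z ℒ⁻¹(0) = ker dℒ_z`. -/
def projDeriv (z : LevelSet) (v : Fin 8 → ℂ) : TangentSpace 𝓘(ℝ, ℂ × ℂ) (proj z) :=
  fderiv ℝ (coord (idx (proj z))) z.1 v

/-- The standard form `dx ∧ dy + du ∧ dv` on `ℂ²`. -/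
def std (v w : ℂ × ℂ) : ℝ :=
  v.1.re * w.1.im - v.1.im * w.1.re + (v.2.re * w.2.im - v.2.im * w.2.re)

theorem fderiv_sec_apply {ν : Fin 8} {q : ℂ × ℂ} (hq : q ∈ dom ν) (v : ℂ × ℂ) (k : Fin 8) :
    fderiv ℝ (sec ν) q v k = fderiv ℝ (fun q => sec ν q k) q v := by
  have h := (contDiffAt_sec hq).differentiableAt (by simp)
  rw [fderiv_pi fun i => differentiableAt_pi.1 h i]
  rfl

/-- In the chart `φ_ν`, the form `ω_st` restricts to the standard form. -/
theorem omegaStd_fderiv_sec {ν : Fin 8} {q : ℂ × ℂ} (hq : q ∈ dom ν) (v w : ℂ × ℂ) :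
    omegaStd ![fderiv ℝ (sec ν) q v, fderiv ℝ (sec ν) q w] = std v w := by
  have h1 : ∀ v, fderiv ℝ (sec ν) q v ν = v.1 := fun v => by
    rw [fderiv_sec_apply hq]
    simp only [sec_fst]
    rw [fderiv_fst]
    rfl
  have h2 : ∀ v, fderiv ℝ (sec ν) q v (ν + 1) = v.2 := fun v => by
    rw [fderiv_sec_apply hq]
    simp only [sec_snd]
    rw [fderiv_snd]
    rfl
  have h3 : ∀ k ∈ others ν, ∀ v, (fderiv ℝ (sec ν) q v k).im = 0 := fun k hk v => by
    have hd : DifferentiableAt ℝ (fun q => sec ν q k) q :=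
      differentiableAt_pi.1 ((contDiffAt_sec hq).differentiableAt (by simp)) k
    have h4 : (fun q => (sec ν q k).im) = fun _ => (0 : ℝ) := by
      funext q
      rw [sec_other hk, Complex.ofReal_im]
    have h5 := (Complex.imCLM.hasFDerivAt.comp q hd.hasFDerivAt).fderiv
    have h6 : Complex.imCLM ∘ (fun q => sec ν q k) = fun _ => (0 : ℝ) := h4
    rw [h6, fderiv_const_apply] at h5
    rw [fderiv_sec_apply hq]
    exact (congrArg (fun L => L v) h5).symm
  rw [omegaStd_apply, others_sum ν, Finset.sum_eq_zero fun k hk => by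
    rw [h3 k hk v, h3 k hk w]; ring]
  simp only [h1, h2, std, add_zero]

theorem chartMap_mem_dom (p : M) : chartMap (idx p) p ∈ dom (idx p) :=
  (chart (idx p)).map_source (mem_chartDomain_idx p)

theorem reducedForm_apply (p : M) (v w : TangentSpace 𝓘(ℝ, ℂ × ℂ) p) :
    reducedForm p ![v, w] = std v w := by
  rw [← omegaStd_fderiv_sec (chartMap_mem_dom p) v w, reducedForm,
    ContinuousAlternatingMap.compContinuousLinearMap_apply]
  congr 1
  funext i
  fin_cases i <;> rfl

theorem std_nondegenerate {v : ℂ × ℂ} (h : ∀ w, std v w = 0) : v = 0 := by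
  have h1 := h (1, 0); have h2 := h (Complex.I, 0)
  have h3 := h (0, 1); have h4 := h (0, Complex.I)
  simp [std] at h1 h2 h3 h4
  exact Prod.ext (Complex.ext h2 h1) (Complex.ext h4 h3)

theorem reducedForm_nondegenerate (p : M) (v : TangentSpace 𝓘(ℝ, ℂ × ℂ) p)
    (h : ∀ w, reducedForm p ![v, w] = 0) : v = 0 :=
  std_nondegenerate fun w => by rw [← reducedForm_apply p v w]; exact h w

theorem hasDerivAt_phase {w : ℂ} (hw : w ≠ 0) (u : ℂ) (n : ℤ) :
    HasDerivAt (fun s : ℝ => ((w + s * u) / (‖w + s * u‖ : ℂ)) ^ n)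
      (Complex.I * (n * ((w.re * u.im - w.im * u.re) / ‖w‖ ^ 2 : ℝ)) * (w / ‖w‖) ^ n) 0 := by
  have h0 : (‖w‖ : ℂ) ≠ 0 := by exact_mod_cast norm_ne_zero_iff.2 hw
  have hr : ‖w‖ ≠ 0 := norm_ne_zero_iff.2 hw
  have hl : HasDerivAt (fun s : ℝ => w + s * u) u 0 := by
    simpa using ((Complex.ofRealCLM.hasDerivAt (x := (0 : ℝ))).mul_const u).const_add w
  have hn : HasDerivAt (fun s : ℝ => ‖w + s * u‖) ((w.re * u.re + w.im * u.im) / ‖w‖) 0 := by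
    have h := hl.norm_sq
    have h' := h.sqrt (by simpa using hr)
    simp only [Real.sqrt_sq (norm_nonneg _)] at h'
    convert h' using 1
    simp [Complex.inner]
    field_simp
  have hd := hl.fun_div hn.ofReal_comp (by simpa using h0)
  have hz := (hasDerivAt_zpow n ((w + (0 : ℝ) * u) / (‖w + (0 : ℝ) * u‖ : ℂ))
    (Or.inl (by simpa using hw))).comp (0 : ℝ) hd
  refine hz.congr_deriv ?_
  have hsq : (‖w‖ : ℂ) ^ 2 = (w.re : ℂ) ^ 2 + (w.im : ℂ) ^ 2 := by
    have := Complex.sq_norm w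
    rw [Complex.normSq_apply] at this
    exact_mod_cast (by rw [this]; ring : ‖w‖ ^ 2 = w.re ^ 2 + w.im ^ 2)
  simp only [Complex.ofReal_zero, zero_mul, add_zero]
  rw [zpow_sub_one₀ (div_ne_zero hw h0)]
  have key : u * (‖w‖ : ℂ) ^ 2 - w * (w.re * u.re + w.im * u.im) =
      Complex.I * (w.re * u.im - w.im * u.re) * w := by
    rw [hsq]
    apply Complex.ext <;> simp [pow_two] <;> ring
  push_cast
  generalize (w / (‖w‖ : ℂ)) ^ n = P
  field_simp
  linear_combination (P * n) * key

theorem hasDerivAt_prod_phase {z : Fin 8 → ℂ} {s : Finset (Fin 8)} (hz : ∀ k ∈ s, z k ≠ 0)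
    (v : Fin 8 → ℂ) (e : Fin 8 → ℤ) :
    HasDerivAt (fun t : ℝ => ∏ k ∈ s, ((z k + t * v k) / (‖z k + t * v k‖ : ℂ)) ^ e k)
      (Complex.I * (∑ k ∈ s, e k * (((z k).re * (v k).im - (z k).im * (v k).re) / ‖z k‖ ^ 2) : ℝ) *
        ∏ k ∈ s, (z k / ‖z k‖) ^ e k) 0 := by
  induction s using Finset.induction_on with
  | empty => simpa using hasDerivAt_const (0 : ℝ) (1 : ℂ)
  | insert i s hi ih =>
    have h1 := hasDerivAt_phase (hz i (Finset.mem_insert_self i s)) (v i) (e i)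
    have h2 := ih fun k hk => hz k (Finset.mem_insert_of_mem hk)
    simp only [Finset.prod_insert hi, Finset.sum_insert hi]
    refine (h1.mul h2).congr_deriv ?_
    simp only [Complex.ofReal_zero, zero_mul, add_zero]
    push_cast
    ring

theorem fderiv_coord {ν : Fin 8} {z : Fin 8 → ℂ} (hz : ∀ k ∈ others ν, z k ≠ 0) :
    ∃ P Q : ℂ, ‖P‖ = 1 ∧ ‖Q‖ = 1 ∧ ∀ v : Fin 8 → ℂ,
      fderiv ℝ (coord ν) z v =
        (P * (v ν + Complex.I * (∑ k ∈ others ν, e₁ ν k *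
          (((z k).re * (v k).im - (z k).im * (v k).re) / ‖z k‖ ^ 2) : ℝ) * z ν),
         Q * (v (ν + 1) + Complex.I * (∑ k ∈ others ν, e₂ ν k *
          (((z k).re * (v k).im - (z k).im * (v k).re) / ‖z k‖ ^ 2) : ℝ) * z (ν + 1))) := by
  have hone : ∀ e : Fin 8 → ℤ, ‖∏ k ∈ others ν, (z k / ‖z k‖) ^ e k‖ = 1 := fun e => by
    rw [norm_prod]
    refine Finset.prod_eq_one fun k hk => ?_
    rw [norm_zpow, norm_div, Complex.norm_real, norm_norm,
      div_self (norm_ne_zero_iff.2 (hz k hk)), one_zpow]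
  refine ⟨_, _, hone (e₁ ν), hone (e₂ ν), fun v => ?_⟩
  have hl : HasDerivAt (fun t : ℝ => z + t • v) v 0 := by
    simpa using ((hasDerivAt_id (0 : ℝ)).smul_const v).const_add z
  have hk : ∀ k, HasDerivAt (fun t : ℝ => z k + t * v k) (v k) 0 := fun k => by
    simpa using ((Complex.ofRealCLM.hasDerivAt (x := (0 : ℝ))).mul_const (v k)).const_add (z k)
  have hc : HasFDerivAt (coord ν) (fderiv ℝ (coord ν) z) (z + (0 : ℝ) • v) := by
    simpa using ((contDiffAt_coord hz).differentiableAt (by simp)).hasFDerivAt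
  have h1 := hc.comp_hasDerivAt (0 : ℝ) hl
  have h2 := ((hk ν).mul (hasDerivAt_prod_phase hz v (e₁ ν))).prodMk
    ((hk (ν + 1)).mul (hasDerivAt_prod_phase hz v (e₂ ν)))
  have h3 := h1.unique h2
  rw [h3]
  ext1
  · simp only [Complex.ofReal_zero, zero_mul, add_zero]
    ring
  · simp only [Complex.ofReal_zero, zero_mul, add_zero]
    ring

theorem cross_mul {P : ℂ} (hP : ‖P‖ = 1) (x y : ℂ) :
    (P * x).re * (P * y).im - (P * x).im * (P * y).re = x.re * y.im - x.im * y.re := by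
  have h : P.re * P.re + P.im * P.im = 1 := by
    have := Complex.sq_norm P
    rw [hP, Complex.normSq_apply] at this
    linarith
  simp only [Complex.mul_re, Complex.mul_im]
  linear_combination (x.re * y.im - x.im * y.re) * h

theorem cross_add (x y z : ℂ) (a b : ℝ) :
    (x + Complex.I * a * z).re * (y + Complex.I * b * z).im -
      (x + Complex.I * a * z).im * (y + Complex.I * b * z).re =
    x.re * y.im - x.im * y.re + (z.re * x.re + z.im * x.im) * b -
      (z.re * y.re + z.im * y.im) * a := by
  simp
  ring

theorem cross_polar {z : ℂ} (hz : z ≠ 0) (x y : ℂ) :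
    x.re * y.im - x.im * y.re =
      (z.re * x.re + z.im * x.im) * ((z.re * y.im - z.im * y.re) / ‖z‖ ^ 2) -
      (z.re * y.re + z.im * y.im) * ((z.re * x.im - z.im * x.re) / ‖z‖ ^ 2) := by
  have h0 : ‖z‖ ^ 2 ≠ 0 := pow_ne_zero _ (norm_ne_zero_iff.2 hz)
  have hs := Complex.sq_norm z
  rw [Complex.normSq_apply] at hs
  rw [eq_sub_iff_add_eq, ← mul_div_assoc, ← mul_div_assoc, eq_div_iff h0, add_mul,
    div_mul_cancel₀ _ h0, hs]
  ring

/-- The differential of the momentum map. -/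
theorem fderiv_momentMap (z v : Fin 8 → ℂ) (j : Fin 6) : fderiv ℝ momentMap z v j =
    -∑ k, (weight j k : ℝ) * ((z k).re * (v k).re + (z k).im * (v k).im) := by
  have hd : Differentiable ℝ momentMap := by
    rw [differentiable_pi]
    intro j
    unfold momentMap
    have : ∀ k : Fin 8, Differentiable ℝ fun z : Fin 8 → ℂ => ‖z k‖ ^ 2 := fun k =>
      (differentiable_apply k).norm_sq ℝ
    fun_prop
  have hl : HasDerivAt (fun t : ℝ => z + t • v) v 0 := by
    simpa using ((hasDerivAt_id (0 : ℝ)).smul_const v).const_add z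
  have hc : HasFDerivAt momentMap (fderiv ℝ momentMap z) (z + (0 : ℝ) • v) := by
    simpa using (hd z).hasFDerivAt
  have h1 := hasDerivAt_pi.1 (hc.comp_hasDerivAt (0 : ℝ) hl) j
  have hk : ∀ k, HasDerivAt (fun t : ℝ => ‖(z + t • v) k‖ ^ 2)
      (2 * ((z k).re * (v k).re + (z k).im * (v k).im)) 0 := fun k => by
    refine (hasDerivAt_pi.1 hl k).norm_sq.congr_deriv ?_
    simp [Complex.inner]
    ring
  have h2 := (((HasDerivAt.fun_sum fun k (_ : k ∈ Finset.univ) =>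
    (hk k).const_mul (weight j k : ℝ)).sub_const (level j)).const_mul (-(1 / 2 : ℝ)))
  rw [h1.unique h2, ← Finset.sum_neg_distrib, Finset.mul_sum]
  exact Finset.sum_congr rfl fun k _ => by ring

theorem std_fderiv_coord {ν : Fin 8} {z : Fin 8 → ℂ} (hz : ∀ k ∈ others ν, z k ≠ 0)
    {v w : Fin 8 → ℂ} (hv : fderiv ℝ momentMap z v = 0) (hw : fderiv ℝ momentMap z w = 0) :
    std (fderiv ℝ (coord ν) z v) (fderiv ℝ (coord ν) z w) = omegaStd ![v, w] := by
  have hm : ∀ v : Fin 8 → ℂ, fderiv ℝ momentMap z v = 0 → ∀ k,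
      (z k).re * (v k).re + (z k).im * (v k).im =
        e₁ ν k * ((z ν).re * (v ν).re + (z ν).im * (v ν).im) +
        e₂ ν k * ((z (ν + 1)).re * (v (ν + 1)).re + (z (ν + 1)).im * (v (ν + 1)).im) :=
    fun v hv k => eq_of_weight_eq_zero
      (x := fun k => (z k).re * (v k).re + (z k).im * (v k).im) (fun j => by
        have := fderiv_momentMap z v j
        rw [hv, Pi.zero_apply] at this
        linarith) ν k
  obtain ⟨P, Q, hP, hQ, h⟩ := fderiv_coord hz
  have hsum := Finset.sum_congr (rfl : others ν = others ν) fun k hk =>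
    (cross_polar (hz k hk) (v k) (w k)).trans (by rw [hm v hv k, hm w hw k])
  have hs : ∀ (β β' : Fin 8 → ℝ) (m n m' n' : ℝ),
      ∑ k ∈ others ν, ((e₁ ν k * m + e₂ ν k * n) * β' k - (e₁ ν k * m' + e₂ ν k * n') * β k) =
      m * (∑ k ∈ others ν, e₁ ν k * β' k) + n * (∑ k ∈ others ν, e₂ ν k * β' k) -
      m' * (∑ k ∈ others ν, e₁ ν k * β k) - n' * (∑ k ∈ others ν, e₂ ν k * β k) := by
    intro β β' m n m' n'
    simp only [Finset.mul_sum, ← Finset.sum_add_distrib, ← Finset.sum_sub_distrib]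
    exact Finset.sum_congr rfl fun k _ => by ring
  rw [hs] at hsum
  rw [omegaStd_apply, others_sum ν, hsum, h v, h w, std, cross_mul hP, cross_mul hQ, cross_add,
    cross_add]
  ring

/-- The defining property `τ^* ω = κ^* ω_st` of the reduced symplectic form. -/
theorem reducedForm_pullback (z : LevelSet) {v w : Fin 8 → ℂ}
    (hv : fderiv ℝ momentMap z.1 v = 0) (hw : fderiv ℝ momentMap z.1 w = 0) :
    reducedForm (proj z) ![projDeriv z v, projDeriv z w] = omegaStd ![v, w] := by
  rw [reducedForm_apply]
  exact std_fderiv_coord (proj_mem_chartDomain.1 (mem_chartDomain_idx (proj z))) hv hw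

theorem fderiv_momentMap_sec {ν : Fin 8} {q : ℂ × ℂ} (hq : q ∈ dom ν) (v : ℂ × ℂ) :
    fderiv ℝ momentMap (sec ν q) (fderiv ℝ (sec ν) q v) = 0 := by
  have hd : Differentiable ℝ momentMap := by
    rw [differentiable_pi]
    intro j
    unfold momentMap
    have : ∀ k : Fin 8, Differentiable ℝ fun z : Fin 8 → ℂ => ‖z k‖ ^ 2 := fun k =>
      (differentiable_apply k).norm_sq ℝ
    fun_prop
  have h1 := (hd (sec ν q)).hasFDerivAt.comp q
    ((contDiffAt_sec hq).differentiableAt (by simp)).hasFDerivAt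
  have h2 : momentMap ∘ sec ν =ᶠ[nhds q] fun _ => 0 := by
    filter_upwards [(isOpen_dom ν).mem_nhds hq] with q' hq'
    exact momentMap_sec hq'
  have h3 := h1.unique ((hasFDerivAt_const (0 : Fin 6 → ℝ) q).congr_of_eventuallyEq h2)
  exact congrArg (fun L => L v) h3

theorem mfderiv_chart_symm {ν : Fin 8} {q : ℂ × ℂ} (hq : q ∈ dom ν) (v : ℂ × ℂ) :
    mfderiv 𝓘(ℝ, ℂ × ℂ) 𝓘(ℝ, ℂ × ℂ) (chart ν).symm q v =
      fderiv ℝ (coord (idx ((chart ν).symm q))) (sec ν q) (fderiv ℝ (sec ν) q v) := by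
  have hmd : MDifferentiableAt 𝓘(ℝ, ℂ × ℂ) 𝓘(ℝ, ℂ × ℂ) (chart ν).symm q :=
    mdifferentiableAt_atlas_symm (I := 𝓘(ℝ, ℂ × ℂ)) (e := chart ν) (mem_atlas_iff.2 ⟨ν, rfl⟩) hq
  have hne := (chart_symm_mem hq).1 (mem_chartDomain_idx ((chart ν).symm q))
  have hc := (((contDiffAt_coord hne).differentiableAt (by simp)).hasFDerivAt.comp q
    ((contDiffAt_sec hq).differentiableAt (by simp)).hasFDerivAt)
  have hev : (chart (idx ((chart ν).symm q)) ∘ (chart ν).symm) =ᶠ[nhds q]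
      (coord (idx ((chart ν).symm q)) ∘ sec ν) := by
    filter_upwards [(isOpen_dom ν).mem_nhds hq] with q' hq'
    exact chart_symm_trans hq'
  have hf := (hc.congr_of_eventuallyEq hev).fderiv
  have hw : writtenInExtChartAt 𝓘(ℝ, ℂ × ℂ) 𝓘(ℝ, ℂ × ℂ) q (chart ν).symm =
      chart (idx ((chart ν).symm q)) ∘ (chart ν).symm := by
    funext x
    simp [writtenInExtChartAt, extChartAt, chartAt_eq, chartAt_self_eq]
  have hm := hmd.mfderiv
  rw [hw] at hm
  simp only [modelWithCornersSelf_coe, Set.range_id, fderivWithin_univ, extChartAt_self_apply]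
    at hm
  exact (congrArg (fun L : (ℂ × ℂ) →L[ℝ] (ℂ × ℂ) => L v) hm).trans
    (congrArg (fun L => L v) hf)

/-- In each of the eight charts, `ω = dx ∧ dy + du ∧ dv`. -/
theorem formInChart_reducedForm {ν : Fin 8} {q : ℂ × ℂ} (hq : q ∈ dom ν) (v : Fin 2 → ℂ × ℂ) :
    formInChart reducedForm (chart ν) q v = std (v 0) (v 1) := by
  have hne := (chart_symm_mem hq).1 (mem_chartDomain_idx ((chart ν).symm q))
  rw [← omegaStd_fderiv_sec hq, ← std_fderiv_coord hne (fderiv_momentMap_sec hq (v 0))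
    (fderiv_momentMap_sec hq (v 1)), ← mfderiv_chart_symm hq, ← mfderiv_chart_symm hq]
  refine Eq.trans ?_ (reducedForm_apply ((chart ν).symm q) _ _)
  refine (formInChart_apply _ _ _ _).trans (congrArg (reducedForm ((chart ν).symm q)) ?_)
  funext i
  fin_cases i <;> rfl

/-- The reduced form on `M` is symplectic. -/
theorem isSymplectic_reducedForm : IsSymplectic reducedForm where
  smooth := by
    rintro _ ⟨ν, rfl⟩
    rcases (dom ν).eq_empty_or_nonempty with h0 | ⟨q₀, hq₀⟩
    · intro q hq
      have hq : q ∈ dom ν := hq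
      simp [h0] at hq
    · refine (contDiffOn_const (c := formInChart reducedForm (chart ν) q₀)).congr fun q hq => ?_
      ext v
      rw [formInChart_reducedForm hq, formInChart_reducedForm hq₀]
  closed := by
    rintro _ ⟨ν, rfl⟩ q hq
    have h : formInChart reducedForm (chart ν) =ᶠ[nhds q]
        fun _ => formInChart reducedForm (chart ν) q := by
      filter_upwards [(isOpen_dom ν).mem_nhds hq] with q' hq'
      ext v
      rw [formInChart_reducedForm hq', formInChart_reducedForm hq]
    rw [extDeriv, h.fderiv_eq, fderiv_const_apply]
    exact map_zero (ContinuousAlternatingMap.alternatizeUncurryFinCLM ℝ (ℂ × ℂ) ℝ)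
  nondegenerate := reducedForm_nondegenerate

/-! ### The family of systems -/

/-- `J([z]) = |z₁|² / 2`. -/
def J : M → ℝ :=
  Quotient.lift (fun z : LevelSet => ‖z.1 0‖ ^ 2 / 2) (by
    rintro z w ⟨θ, rfl⟩
    simp only [smul_val, norm_mul, Circle.norm_coe, one_mul])

/-- `H([z]) = |z₃|² / 2`. -/
def H : M → ℝ :=
  Quotient.lift (fun z : LevelSet => ‖z.1 2‖ ^ 2 / 2) (by
    rintro z w ⟨θ, rfl⟩
    simp only [smul_val, norm_mul, Circle.norm_coe, one_mul])

theorem torusChar_γ (θ : Fin 6 → Circle) :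
    (torusChar θ 1 * torusChar θ 2 * torusChar θ 3)⁻¹ *
      (torusChar θ 5 * torusChar θ 6 * torusChar θ 7) = 1 := by
  have h := torusChar_prod (e := ![0, -1, -1, -1, 0, 1, 1, 1]) (by decide) θ
  rw [Fin.prod_univ_eight] at h
  simp at h
  rw [← h]
  simp only [mul_inv_rev, mul_comm, mul_assoc]

/-- `γ₁([z]) = (1/50) Re(conj(z₂ z₃ z₄) z₆ z₇ z₈)`. -/
def γ₁ : M → ℝ :=
  Quotient.lift (fun z : LevelSet => 1 / 50 *
    (starRingEnd ℂ (z.1 1 * z.1 2 * z.1 3) * (z.1 5 * z.1 6 * z.1 7)).re) (by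
    rintro z w ⟨θ, rfl⟩
    have h : starRingEnd ℂ (torusChar θ 1 * torusChar θ 2 * torusChar θ 3 : ℂ) *
        (torusChar θ 5 * torusChar θ 6 * torusChar θ 7) = 1 := by
      have := congrArg (fun c : Circle => (c : ℂ)) (torusChar_γ θ)
      rwa [Circle.coe_mul, Circle.coe_inv_eq_conj] at this
    have e : ∀ a b c d f g x y v x' y' v' : ℂ,
        starRingEnd ℂ (a * x * (b * y) * (c * v)) * (d * x' * (f * y') * (g * v')) =
        (starRingEnd ℂ (a * b * c) * (d * f * g)) *
          (starRingEnd ℂ (x * y * v) * (x' * y' * v')) := by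
      intros
      simp only [map_mul]
      ring
    dsimp only
    congr 2
    refine (e _ _ _ _ _ _ _ _ _ _ _ _).trans ?_
    rw [h, one_mul])

/-- `γ₂([z]) = (1/50) |z₅|⁴ |z₄|⁴`. -/
def γ₂ : M → ℝ :=
  Quotient.lift (fun z : LevelSet => 1 / 50 * (‖z.1 4‖ ^ 4 * ‖z.1 3‖ ^ 4)) (by
    rintro z w ⟨θ, rfl⟩
    simp only [smul_val, norm_mul, Circle.norm_coe, one_mul])

/-- `γ₃([z]) = (1/50) |z₄|⁴ |z₇|⁴`. -/
def γ₃ : M → ℝ :=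
  Quotient.lift (fun z : LevelSet => 1 / 50 * (‖z.1 3‖ ^ 4 * ‖z.1 6‖ ^ 4)) (by
    rintro z w ⟨θ, rfl⟩
    simp only [smul_val, norm_mul, Circle.norm_coe, one_mul])

/-- `γ₄([z]) = (1/100) |z₅|⁴ |z₇|⁴`. -/
def γ₄ : M → ℝ :=
  Quotient.lift (fun z : LevelSet => 1 / 100 * (‖z.1 4‖ ^ 4 * ‖z.1 6‖ ^ 4)) (by
    rintro z w ⟨θ, rfl⟩
    simp only [smul_val, norm_mul, Circle.norm_coe, one_mul])

/-- `H_t = (1 - 2 t₁) H + t₁ γ₁ + t₂ γ₂ + t₃ γ₃ + t₄ γ₄` for `t ∈ ℝ⁴`. -/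
def Ht (t : Fin 4 → ℝ) (p : M) : ℝ :=
  (1 - 2 * t 0) * H p + t 0 * γ₁ p + t 1 * γ₂ p + t 2 * γ₃ p + t 3 * γ₄ p

end OctagonSystem

end

/-! The symplectic part is `isSymplectic_reducedForm`: in each of the eight charts the form is
`std`. Hence all statements about `J` and `H_t` become statements about ordinary derivatives of `J ∘
param ν` and `Ht t ∘ param ν`.

Commutation: `J` generates the circle action that rotates `z₁`, and `H_t` is built from `z₂, …, z₈`
only. In the chart `φ_ν` this action has weights `(e₁ ν 0, e₂ ν 0)` (`coord_rotate`), its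
infinitesimal generator with the right sign is the Hamiltonian field of `J` (`hamVF_J`), and `H_t`
is constant along it (`fderiv_Ht_param_rotationField`). So `{J, H_t} = -dH_t(X^J) = 0`.

Independence: in the chart `φ_0`, with coordinates `(a, b) = (z₁, z₂)`, `J = |a|²/2`. Where `a ≠ 0`,
it is enough that `H_t` has a nonzero derivative in some direction that moves only `b`
(`isRegular_zero`). By `Ht_param_zero`, `H_t` is a polynomial in `|a|²` and `|b|²` plus `t₁/50`
times a positive function of the moduli times `Re b`. If `t₁ ≠ 0`, rotating `b` changes only `Re b`,
at the rate `-Im b`, so the points with `Im b ≠ 0` are regular. If `t₁ = 0`, scaling `b` gives the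
derivative `2|b|²` times `slope`. This is a polynomial in the moduli squared which is not
identically zero whatever `t` is, so its zero set is null by Fubini (`volume_slope_eq_zero`).

Finally, a point of any chart with both coordinates nonzero has all `z_k ≠ 0` and so lies in the
chart `φ_0`. The smooth transition maps preserve null sets, so one chart suffices
(`almostEverywhere_of_chart_zero`). -/

noncomputable section

namespace OctagonSystem

/-! ### Smooth functions on `M` in the charts -/

/-- A function on `M` is smooth if it is induced by a smooth function on `ℂ⁸`. -/
theorem contMDiff_of_lift {E : Type*} [NormedAddCommGroup E] [NormedSpace ℝ E] {f : M → E}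
    {F : (Fin 8 → ℂ) → E} (hF : ContDiff ℝ ∞ F) (h : ∀ z : LevelSet, f (proj z) = F z.1) :
    ContMDiff 𝓘(ℝ, ℂ × ℂ) 𝓘(ℝ, E) ∞ f := by
  intro p
  have hp := mem_chartDomain_idx p
  have h1 : ContMDiffAt 𝓘(ℝ, ℂ × ℂ) 𝓘(ℝ, ℂ × ℂ) ∞ (chart (idx p)) p :=
    contMDiffAt_of_mem_maximalAtlas
      (IsManifold.subset_maximalAtlas (mem_atlas_iff.2 ⟨idx p, rfl⟩)) hp
  have h2 : ContMDiffAt 𝓘(ℝ, ℂ × ℂ) 𝓘(ℝ, E) ∞ (F ∘ sec (idx p)) (chart (idx p) p) :=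
    (hF.contDiffAt.comp _ (contDiffAt_sec (chartMap_mem_dom p))).contMDiffAt
  refine (h2.comp p h1).congr_of_eventuallyEq ?_
  filter_upwards [(isOpen_chartDomain (idx p)).mem_nhds hp] with x hx
  have hd : chartMap (idx p) x ∈ dom (idx p) := (chart (idx p)).map_source hx
  -- Near `p` a point is the class of the value of the local section at its coordinates, so `f`
  -- factors as `F ∘ sec ∘ chart`.
  conv_lhs => rw [← param_chartMap hx, param_eq hd, h]
  rfl

theorem mdifferentiableAt_chart_symm {ν : Fin 8} {q : ℂ × ℂ} (hq : q ∈ dom ν) :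
    MDifferentiableAt 𝓘(ℝ, ℂ × ℂ) 𝓘(ℝ, ℂ × ℂ) (chart ν).symm q :=
  mdifferentiableAt_atlas_symm (I := 𝓘(ℝ, ℂ × ℂ)) (e := chart ν) (mem_atlas_iff.2 ⟨ν, rfl⟩) hq

section Chart

variable {E : Type*} [NormedAddCommGroup E] [NormedSpace ℝ E] {f : M → E}

theorem differentiableAt_comp_param (hf : ContMDiff 𝓘(ℝ, ℂ × ℂ) 𝓘(ℝ, E) ∞ f) {ν : Fin 8}
    {q : ℂ × ℂ} (hq : q ∈ dom ν) : DifferentiableAt ℝ (f ∘ param ν) q :=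
  mdifferentiableAt_iff_differentiableAt.1
    (((hf.mdifferentiable (by simp)) (param ν q)).comp q (mdifferentiableAt_chart_symm hq))

/-- The chain rule for `f ∘ (chart ν).symm`. It evaluates `df` in an arbitrary chart, which is
needed because regularity is checked in `φ_0`, whatever the preferred chart at the point is. -/
theorem mfderiv_mfderiv_chart_symm (hf : ContMDiff 𝓘(ℝ, ℂ × ℂ) 𝓘(ℝ, E) ∞ f) {ν : Fin 8}
    {q : ℂ × ℂ} (hq : q ∈ dom ν) (v : ℂ × ℂ) :
    mfderiv 𝓘(ℝ, ℂ × ℂ) 𝓘(ℝ, E) f ((chart ν).symm q)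
      (mfderiv 𝓘(ℝ, ℂ × ℂ) 𝓘(ℝ, ℂ × ℂ) (chart ν).symm q v) = fderiv ℝ (f ∘ param ν) q v := by
  have h := mfderiv_comp q (hf.mdifferentiable (by simp) ((chart ν).symm q))
    (mdifferentiableAt_chart_symm hq)
  rw [mfderiv_eq_fderiv] at h
  exact (congrArg (fun L : (ℂ × ℂ) →L[ℝ] E => L v) h).symm

/-- The tangent space at `p` is identified with `ℂ × ℂ` through the preferred chart, so there no
change of coordinates enters. This is the form used for pointwise identities such as the Poisson
bracket. -/
theorem mfderiv_eq_fderiv_param (hf : ContMDiff 𝓘(ℝ, ℂ × ℂ) 𝓘(ℝ, E) ∞ f) (p : M) (v : ℂ × ℂ) :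
    mfderiv 𝓘(ℝ, ℂ × ℂ) 𝓘(ℝ, E) f p v = fderiv ℝ (f ∘ param (idx p)) (chartMap (idx p) p) v := by
  have hm := (hf.mdifferentiable (by simp) p).mfderiv
  have hw : writtenInExtChartAt 𝓘(ℝ, ℂ × ℂ) 𝓘(ℝ, E) p f = f ∘ param (idx p) := by
    funext x
    simp [writtenInExtChartAt, extChartAt, chartAt_eq]
    rfl
  rw [hw] at hm
  have hx : extChartAt 𝓘(ℝ, ℂ × ℂ) p p = chartMap (idx p) p := by
    simp [extChartAt, chartAt_eq]
    rfl
  simp only [modelWithCornersSelf_coe, Set.range_id, fderivWithin_univ, hx] at hm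
  exact congrArg (fun L : (ℂ × ℂ) →L[ℝ] E => L v) hm

theorem hasDerivAt_comp_param (hf : ContMDiff 𝓘(ℝ, ℂ × ℂ) 𝓘(ℝ, E) ∞ f) {ν : Fin 8}
    {c : ℝ → ℂ × ℂ} {v : ℂ × ℂ} (hq : c 0 ∈ dom ν) (hc : HasDerivAt c v 0) :
    HasDerivAt (fun s => f (param ν (c s))) (fderiv ℝ (f ∘ param ν) (c 0) v) 0 :=
  (differentiableAt_comp_param hf hq).hasFDerivAt.comp_hasDerivAt 0 hc

end Chart

/-! ### The functions of the system -/

theorem J_proj (z : LevelSet) : J (proj z) = ‖z.1 0‖ ^ 2 / 2 := rfl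

theorem Ht_proj (t : Fin 4 → ℝ) (z : LevelSet) : Ht t (proj z) =
    (1 - 2 * t 0) * (‖z.1 2‖ ^ 2 / 2) +
    t 0 * (1 / 50 * (starRingEnd ℂ (z.1 1 * z.1 2 * z.1 3) * (z.1 5 * z.1 6 * z.1 7)).re) +
    t 1 * (1 / 50 * (‖z.1 4‖ ^ 4 * ‖z.1 3‖ ^ 4)) + t 2 * (1 / 50 * (‖z.1 3‖ ^ 4 * ‖z.1 6‖ ^ 4)) +
    t 3 * (1 / 100 * (‖z.1 4‖ ^ 4 * ‖z.1 6‖ ^ 4)) := rfl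

theorem contDiff_norm_sq_apply (k : Fin 8) : ContDiff ℝ ∞ fun z : Fin 8 → ℂ => ‖z k‖ ^ 2 :=
  (contDiff_apply ℝ ℂ k).norm_sq ℝ

theorem contMDiff_J : ContMDiff 𝓘(ℝ, ℂ × ℂ) 𝓘(ℝ, ℝ) ∞ J :=
  contMDiff_of_lift (F := fun z => ‖z 0‖ ^ 2 / 2)
    ((contDiff_norm_sq_apply 0).div_const 2) J_proj

theorem contMDiff_Ht (t : Fin 4 → ℝ) : ContMDiff 𝓘(ℝ, ℂ × ℂ) 𝓘(ℝ, ℝ) ∞ (Ht t) := by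
  -- Fourth powers of norms are written as squares of `‖z k‖ ^ 2`, which is smooth at zero too,
  -- unlike the norm itself.
  refine contMDiff_of_lift (F := fun z =>
    (1 - 2 * t 0) * (‖z 2‖ ^ 2 / 2) +
    t 0 * (1 / 50 * (starRingEnd ℂ (z 1 * z 2 * z 3) * (z 5 * z 6 * z 7)).re) +
    t 1 * (1 / 50 * ((‖z 4‖ ^ 2) ^ 2 * (‖z 3‖ ^ 2) ^ 2)) +
    t 2 * (1 / 50 * ((‖z 3‖ ^ 2) ^ 2 * (‖z 6‖ ^ 2) ^ 2)) +
    t 3 * (1 / 100 * ((‖z 4‖ ^ 2) ^ 2 * (‖z 6‖ ^ 2) ^ 2))) ?_ fun z => ?_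
  · have hk := fun k : Fin 8 => contDiff_apply (n := ∞) ℝ ℂ k
    have h2 := contDiff_norm_sq_apply 2
    have h3 := contDiff_norm_sq_apply 3
    have h4 := contDiff_norm_sq_apply 4
    have h6 := contDiff_norm_sq_apply 6
    have hc : ContDiff ℝ ∞ fun z : Fin 8 → ℂ => starRingEnd ℂ (z 1 * z 2 * z 3) :=
      Complex.conjCLE.contDiff.comp (((hk 1).mul (hk 2)).mul (hk 3))
    have hre : ContDiff ℝ ∞ fun z : Fin 8 → ℂ =>
        (starRingEnd ℂ (z 1 * z 2 * z 3) * (z 5 * z 6 * z 7)).re :=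
      Complex.reCLM.contDiff.comp (hc.mul (((hk 5).mul (hk 6)).mul (hk 7)))
    fun_prop
  · rw [Ht_proj]
    ring

/-! ### The functions `J` and `H_t` Poisson commute -/

/-- The rotation of the first coordinate of `ℂ⁸`. -/
def rotate (ζ : Circle) (z : LevelSet) : LevelSet :=
  ⟨fun k => (Function.update (1 : Fin 8 → Circle) 0 ζ k : ℂ) * z.1 k, by
    have hn : ∀ k, ‖(Function.update (1 : Fin 8 → Circle) 0 ζ k : ℂ) * z.1 k‖ = ‖z.1 k‖ :=
      fun k => by rw [norm_mul, Circle.norm_coe, one_mul]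
    refine Eq.trans ?_ z.2
    funext j
    simp only [momentMap, hn]⟩

theorem rotate_ne (ζ : Circle) (z : LevelSet) {k : Fin 8} (hk : k ≠ 0) :
    (rotate ζ z).1 k = z.1 k := by
  simp [rotate, hk]

theorem Ht_proj_rotate (t : Fin 4 → ℝ) (ζ : Circle) (z : LevelSet) :
    Ht t (proj (rotate ζ z)) = Ht t (proj z) := by
  simp only [Ht_proj]
  -- One rewrite for each of the indices `1, …, 7`; the index `0`, the only one affected by the
  -- rotation, does not occur.
  iterate 7 rw [rotate_ne ζ z (by decide)]

theorem update_one_prod (ζ : Circle) (e : Fin 8 → ℤ) :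
    ∏ k, Function.update (1 : Fin 8 → Circle) 0 ζ k ^ e k = ζ ^ e 0 := by
  rw [Finset.prod_eq_single 0 (fun k _ hk => by simp [hk]) (by simp)]
  simp

/-- Same computation as for `coord_act`, but the phases `η` lie outside the image of `𝕋⁶` in
general. The product of all `η k ^ e₁ ν k` is then `ζ ^ e₁ ν 0` instead of `1`, and likewise for
`e₂`. -/
theorem coord_rotate (ν : Fin 8) (ζ : Circle) (z : LevelSet) :
    coord ν (rotate ζ z).1 =
      ((ζ : ℂ) ^ e₁ ν 0 * (coord ν z.1).1, (ζ : ℂ) ^ e₂ ν 0 * (coord ν z.1).2) := by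
  set η := Function.update (1 : Fin 8 → Circle) 0 ζ with hη
  have hr : (rotate ζ z).1 = fun k => (η k : ℂ) * z.1 k := rfl
  have h : ∀ k, (η k * z.1 k) / ‖(η k * z.1 k : ℂ)‖ = η k * (z.1 k / ‖z.1 k‖) := fun k => by
    rw [norm_mul, Circle.norm_coe, one_mul, mul_div_assoc]
  have c1 : (η ν : ℂ) * ∏ k ∈ others ν, (η k : ℂ) ^ e₁ ν k = (ζ : ℂ) ^ e₁ ν 0 := by
    have := update_one_prod ζ (e₁ ν)
    rw [others_prod ν, e₁_self, e₁_succ, zpow_one, zpow_zero, mul_one] at this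
    have := congrArg Circle.coeHom this
    simp only [map_mul, map_prod, map_zpow] at this
    exact this
  have c2 : (η (ν + 1) : ℂ) * ∏ k ∈ others ν, (η k : ℂ) ^ e₂ ν k = (ζ : ℂ) ^ e₂ ν 0 := by
    have := update_one_prod ζ (e₂ ν)
    rw [others_prod ν, e₂_self, e₂_succ, zpow_one, zpow_zero, one_mul] at this
    have := congrArg Circle.coeHom this
    simp only [map_mul, map_prod, map_zpow] at this
    exact this
  rw [hr]
  unfold coord
  simp only [h, mul_zpow, Finset.prod_mul_distrib]
  ext1
  · dsimp only
    linear_combination (z.1 ν * ∏ k ∈ others ν, (z.1 k / ‖z.1 k‖) ^ e₁ ν k) * c1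
  · dsimp only
    linear_combination (z.1 (ν + 1) * ∏ k ∈ others ν, (z.1 k / ‖z.1 k‖) ^ e₂ ν k) * c2

theorem Ht_param_rotate (t : Fin 4 → ℝ) {ν : Fin 8} {q : ℂ × ℂ} (hq : q ∈ dom ν) (ζ : Circle) :
    Ht t (param ν ((ζ : ℂ) ^ e₁ ν 0 * q.1, (ζ : ℂ) ^ e₂ ν 0 * q.2)) = Ht t (param ν q) := by
  -- The rotated point may leave the image of `φ_ν`, but its class stays in the chart domain, so it
  -- is recovered from its coordinates.
  have hz : ∀ k ∈ others ν, (rotate ζ ⟨sec ν q, momentMap_sec hq⟩).1 k ≠ 0 := fun k hk =>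
    mul_ne_zero (Circle.coe_ne_zero _) (sec_ne_zero hq hk)
  have h := param_chartMap (proj_mem_chartDomain.2 hz)
  rw [chartMap_proj, coord_rotate, coord_sec hq] at h
  rw [h, Ht_proj_rotate, param_eq hq]

theorem J_param {ν : Fin 8} {q : ℂ × ℂ} (hq : q ∈ dom ν) :
    J (param ν q) = radicand ν 0 q / 2 := by
  rw [param_eq hq, J_proj, normSq_sec hq]

/-- The Hamiltonian vector field of `J` in the chart `φ_ν`. -/
def rotationField (ν : Fin 8) (q : ℂ × ℂ) : ℂ × ℂ :=
  (-(Complex.I * e₁ ν 0 * q.1), -(Complex.I * e₂ ν 0 * q.2))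

/-- In the chart, `J` is affine in `|q.1|²` and `|q.2|²` with coefficients `e₁ ν 0 / 2` and `e₂ ν 0
/ 2`, and the differential of `|a|²/2` is the pairing with `-i a`. -/
theorem fderiv_J_param {ν : Fin 8} {q : ℂ × ℂ} (hq : q ∈ dom ν) (w : ℂ × ℂ) :
    fderiv ℝ (J ∘ param ν) q w = std (rotationField ν q) w := by
  have hev : (J ∘ param ν) =ᶠ[nhds q] fun q => radicand ν 0 q / 2 := by
    filter_upwards [(isOpen_dom ν).mem_nhds hq] with q' hq'
    exact J_param hq'
  have h1 : HasFDerivAt (fun q : ℂ × ℂ => ‖q.1‖ ^ 2) _ q := hasFDerivAt_fst.norm_sq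
  have h2 : HasFDerivAt (fun q : ℂ × ℂ => ‖q.2‖ ^ 2) _ q := hasFDerivAt_snd.norm_sq
  have h := ((((h1.sub_const (offset ν)).const_mul (e₁ ν 0 : ℝ)).const_add (offset 0)).add
    ((h2.sub_const (offset (ν + 1))).const_mul (e₂ ν 0 : ℝ))).mul_const (1 / 2 : ℝ)
  have h' : HasFDerivAt (fun q => radicand ν 0 q / 2) _ q :=
    h.congr_of_eventuallyEq (.of_forall fun q => by simp [radicand, div_eq_mul_inv])
  rw [hev.fderiv_eq, h'.fderiv]
  simp [std, rotationField, Complex.inner]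
  ring

/-- The field is the velocity at `s = 0` of the rotation of `z₁` by `exp(-is)`, and `H_t` is
constant along that curve. -/
theorem fderiv_Ht_param_rotationField (t : Fin 4 → ℝ) {ν : Fin 8} {q : ℂ × ℂ} (hq : q ∈ dom ν) :
    fderiv ℝ (Ht t ∘ param ν) q (rotationField ν q) = 0 := by
  have he : ∀ (n : ℤ) (a : ℂ), HasDerivAt (fun s : ℝ => Complex.exp (-(n * s * Complex.I)) * a)
      (-(Complex.I * n * a)) 0 := fun n a => by
    have h1 := ((((Complex.ofRealCLM.hasDerivAt (x := (0 : ℝ))).const_mul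
      (n : ℂ)).mul_const Complex.I).neg.cexp).mul_const a
    refine h1.congr_deriv ?_
    simp [mul_comm]
  have hc := (he (e₁ ν 0) q.1).prodMk (he (e₂ ν 0) q.2)
  have h := hasDerivAt_comp_param (contMDiff_Ht t) (ν := ν) (by simpa using hq) hc
  have hconst : ∀ s : ℝ, Ht t (param ν (Complex.exp (-(e₁ ν 0 * s * Complex.I)) * q.1,
      Complex.exp (-(e₂ ν 0 * s * Complex.I)) * q.2)) = Ht t (param ν q) := fun s => by
    -- The exponential form is convenient for differentiating; the form as a power of a unit complex
    -- number is what `Ht_param_rotate` needs.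
    have hz : ∀ n : ℤ, Complex.exp (-(n * s * Complex.I)) = (Circle.exp (-s) : ℂ) ^ n := fun n => by
      rw [Circle.coe_exp, ← Complex.exp_int_mul]
      congr 1
      push_cast
      ring
    rw [hz, hz, Ht_param_rotate t hq]
  simp only [hconst] at h
  have h0 := h.unique (hasDerivAt_const (0 : ℝ) (Ht t (param ν q)))
  simpa [rotationField] using h0

/-! ### Hamiltonian vector fields in the preferred chart. -/

theorem std_hamVF {f : M → ℝ} (hf : ContMDiff 𝓘(ℝ, ℂ × ℂ) 𝓘(ℝ, ℝ) ∞ f) (p : M) (w : ℂ × ℂ) :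
    std (hamVF reducedForm f p) w = fderiv ℝ (f ∘ param (idx p)) (chartMap (idx p) p) w :=
  (reducedForm_apply p _ w).symm.trans
    ((hamVF_spec (reducedForm_nondegenerate p) f w).trans (mfderiv_eq_fderiv_param hf p w))

theorem hamVF_J (p : M) :
    hamVF reducedForm J p = rotationField (idx p) (chartMap (idx p) p) := by
  refine sub_eq_zero.1 (std_nondegenerate fun w => ?_)
  have h1 := std_hamVF contMDiff_J p w
  rw [fderiv_J_param (chartMap_mem_dom p)] at h1
  have h2 : ∀ u v : ℂ × ℂ, std (u - v) w = std u w - std v w := fun u v => by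
    simp only [std, Prod.fst_sub, Prod.snd_sub, Complex.sub_re, Complex.sub_im]
    ring
  exact (h2 _ _).trans (sub_eq_zero.2 h1)

theorem poissonBracket_J_Ht (t : Fin 4 → ℝ) (p : M) :
    poissonBracket reducedForm J (Ht t) p = 0 := by
  -- This computes `ω(X^{H_t}, X^J) = dH_t(X^J)`; the bracket is its negative by antisymmetry of
  -- `std`.
  have h1 := std_hamVF (contMDiff_Ht t) p (hamVF reducedForm J p)
  have h2 : fderiv ℝ (Ht t ∘ param (idx p)) (chartMap (idx p) p) (hamVF reducedForm J p) = 0 :=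
    (congrArg _ (hamVF_J p)).trans (fderiv_Ht_param_rotationField t (chartMap_mem_dom p))
  rw [h2] at h1
  refine (reducedForm_apply p _ _).trans ?_
  simp only [std] at h1 ⊢
  linarith

/-! ### Regular points -/

/-- `q` is a regular point of `(f, g)` in the chart `φ_ν`, with `df` and `dg` separated by two
tangent vectors. -/
def IsRegular (f g : M → ℝ) (ν : Fin 8) (q : ℂ × ℂ) : Prop :=
  ∃ v w : ℂ × ℂ, fderiv ℝ (f ∘ param ν) q v ≠ 0 ∧ fderiv ℝ (f ∘ param ν) q w = 0 ∧
    fderiv ℝ (g ∘ param ν) q w ≠ 0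

/-- Pairing a relation `a X^f + b X^g = 0` with a tangent vector gives `a df + b dg = 0`. Testing on
`w`, where `df` vanishes, kills `b`, and testing on `v` then kills `a`. -/
theorem IsRegular.linearIndependent {f g : M → ℝ} (hf : ContMDiff 𝓘(ℝ, ℂ × ℂ) 𝓘(ℝ, ℝ) ∞ f)
    (hg : ContMDiff 𝓘(ℝ, ℂ × ℂ) 𝓘(ℝ, ℝ) ∞ g) {ν : Fin 8} {q : ℂ × ℂ} (hq : q ∈ dom ν)
    (h : IsRegular f g ν q) : LinearIndependent ℝ
      ![hamVF reducedForm f ((chart ν).symm q), hamVF reducedForm g ((chart ν).symm q)] := by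
  obtain ⟨v, w, hv, hw, hgw⟩ := h
  rw [LinearIndependent.pair_iff]
  intro a b hab
  have key : ∀ u : ℂ × ℂ,
      a * fderiv ℝ (f ∘ param ν) q u + b * fderiv ℝ (g ∘ param ν) q u = 0 := fun u => by
    set p := (chart ν).symm q
    set y : TangentSpace 𝓘(ℝ, ℂ × ℂ) p := mfderiv 𝓘(ℝ, ℂ × ℂ) 𝓘(ℝ, ℂ × ℂ) (chart ν).symm q u
    have h1 : reducedForm p ![hamVF reducedForm f p, y] = fderiv ℝ (f ∘ param ν) q u :=
      (hamVF_spec (reducedForm_nondegenerate p) f y).trans (mfderiv_mfderiv_chart_symm hf hq u)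
    have h2 : reducedForm p ![hamVF reducedForm g p, y] = fderiv ℝ (g ∘ param ν) q u :=
      (hamVF_spec (reducedForm_nondegenerate p) g y).trans (mfderiv_mfderiv_chart_symm hg hq u)
    -- The vanishing of `ω(0, y)`, written with a zero multiple so that `pair_smul_left` proves it;
    -- the zero vector is then replaced by the relation `hab`.
    have h3 : reducedForm p ![(0 : ℝ) • hamVF reducedForm f p, y] = 0 := by
      rw [pair_smul_left, zero_smul]
    rw [zero_smul, ← hab, pair_add_left, pair_smul_left, pair_smul_left, h1, h2] at h3
    exact h3
  have hb : b = 0 := by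
    have := key w
    rw [hw, mul_zero, zero_add] at this
    exact (mul_eq_zero.1 this).resolve_right hgw
  have ha := key v
  rw [hb, zero_mul, add_zero] at ha
  exact ⟨(mul_eq_zero.1 ha).resolve_right hv, hb⟩

theorem IsRegular.finrank_range {f g : M → ℝ} (hf : ContMDiff 𝓘(ℝ, ℂ × ℂ) 𝓘(ℝ, ℝ) ∞ f)
    (hg : ContMDiff 𝓘(ℝ, ℂ × ℂ) 𝓘(ℝ, ℝ) ∞ g) {ν : Fin 8} {q : ℂ × ℂ} (hq : q ∈ dom ν)
    (h : IsRegular f g ν q) : Module.finrank ℝ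
      (mfderiv 𝓘(ℝ, ℂ × ℂ) 𝓘(ℝ, ℝ × ℝ) (fun p => (f p, g p))
        ((chart ν).symm q)).toLinearMap.range = 2 := by
  obtain ⟨v, w, hv, hw, hgw⟩ := h
  have hfg : ContMDiff 𝓘(ℝ, ℂ × ℂ) 𝓘(ℝ, ℝ × ℝ) ∞ fun p => (f p, g p) := hf.prodMk_space hg
  have hd : ∀ u, fderiv ℝ ((fun p => (f p, g p)) ∘ param ν) q u =
      (fderiv ℝ (f ∘ param ν) q u, fderiv ℝ (g ∘ param ν) q u) := fun u =>
    congrArg (fun L : (ℂ × ℂ) →L[ℝ] (ℝ × ℝ) => L u)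
      ((differentiableAt_comp_param hf hq).fderiv_prodMk (differentiableAt_comp_param hg hq))
  set x := fderiv ℝ (f ∘ param ν) q v
  set y := fderiv ℝ (g ∘ param ν) q v
  set z := fderiv ℝ (g ∘ param ν) q w
  have htop : (mfderiv 𝓘(ℝ, ℂ × ℂ) 𝓘(ℝ, ℝ × ℝ) (fun p => (f p, g p))
      ((chart ν).symm q)).toLinearMap.range = ⊤ := by
    rw [LinearMap.range_eq_top]
    intro r
    obtain ⟨r₁, r₂⟩ : ℝ × ℝ := r
    -- On `v, w` the pair `(df, dg)` takes the values `(x, y)` and `(0, z)`. This triangular system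
    -- is solved for `v` first, then `w` corrects the second entry.
    let u : ℂ × ℂ := (r₁ / x) • v + ((r₂ - r₁ / x * y) / z) • w
    refine ⟨mfderiv 𝓘(ℝ, ℂ × ℂ) 𝓘(ℝ, ℂ × ℂ) (chart ν).symm q u, ?_⟩
    refine (mfderiv_mfderiv_chart_symm hfg hq u).trans ?_
    rw [map_add, map_smul, map_smul, hd, hd, hw]
    refine Prod.ext ?_ ?_
    · simp [x, hv]
    · change r₁ / x * y + (r₂ - r₁ / x * y) / z * z = r₂
      field_simp
      ring
  rw [htop, finrank_top]
  change Module.finrank ℝ (ℝ × ℝ) = 2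
  simp

/-! ### Regularity in the chart `φ_0`. -/

/-- Here `J = |a|²/2`, so `dJ` is nonzero on the radial vector `(a, 0)` and vanishes on all `(0,
u)`. Only a curve moving `b` alone has to be tested on `g`. -/
theorem isRegular_zero {g : M → ℝ} (hg : ContMDiff 𝓘(ℝ, ℂ × ℂ) 𝓘(ℝ, ℝ) ∞ g) {a b : ℂ}
    (hq : (a, b) ∈ dom 0) (ha : a ≠ 0) {c : ℝ → ℂ} {u : ℂ} (hc : HasDerivAt c u 0) (hc0 : c 0 = b)
    {d : ℝ} (hd : HasDerivAt (fun s => g (param 0 (a, c s))) d 0) (hne : d ≠ 0) :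
    IsRegular J g 0 (a, b) := by
  subst hc0
  refine ⟨(a, 0), (0, u), ?_, ?_, ?_⟩
  · rw [fderiv_J_param hq]
    have : a.re * a.re + a.im * a.im ≠ 0 := by
      rw [← Complex.normSq_apply]
      exact (Complex.normSq_pos.2 ha).ne'
    simp [std, rotationField, e₁_self]
    intro h
    apply this
    linarith
  · rw [fderiv_J_param hq]
    simp [std, rotationField, e₂_self]
  · have h := (hasDerivAt_comp_param hg (c := fun s => (a, c s)) hq
      ((hasDerivAt_const (0 : ℝ) a).prodMk hc)).unique hd
    rwa [h]

theorem mem_dom_congr {q q' : ℂ × ℂ} (h1 : ‖q.1‖ = ‖q'.1‖) (h2 : ‖q.2‖ = ‖q'.2‖) {ν : Fin 8}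
    (hq : q ∈ dom ν) : q' ∈ dom ν := fun k hk => by
  rw [← radicand_congr h1 h2]
  exact hq k hk

/-- The part of `H_t` that depends on the `|z_k|²` only, as a function of `|z₁|²` and `|z₂|²`. -/
def normPart (t : Fin 4 → ℝ) (x y : ℝ) : ℝ :=
  (1 - 2 * t 0) * ((2 - x + y) / 2) + t 1 * (1 / 50 * ((6 - x) ^ 2 * (6 - 2 * x + y) ^ 2)) +
    t 2 * (1 / 50 * ((6 - 2 * x + y) ^ 2 * (4 + x - y) ^ 2)) +
    t 3 * (1 / 100 * ((6 - x) ^ 2 * (4 + x - y) ^ 2))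

/-- The coefficient of `Re z₂` in `Re(conj(z₂ z₃ z₄) z₆ z₇ z₈)` in the chart `φ_0`. -/
def crossCoeff (q : ℂ × ℂ) : ℝ :=
  √(radicand 0 2 q) * √(radicand 0 3 q) * (√(radicand 0 5 q) * √(radicand 0 6 q) * √(radicand 0 7 q))

theorem crossCoeff_pos {q : ℂ × ℂ} (hq : q ∈ dom 0) : 0 < crossCoeff q := by
  have h : ∀ k ∈ others 0, 0 < √(radicand 0 k q) := fun k hk => Real.sqrt_pos.2 (hq k hk)
  exact mul_pos (mul_pos (h 2 (by decide)) (h 3 (by decide)))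
    (mul_pos (mul_pos (h 5 (by decide)) (h 6 (by decide))) (h 7 (by decide)))

/-- On the section `φ_0` the coordinates `z₃, …, z₈` are positive reals, so `conj z₂` is the only
factor in `γ₁` that need not be real. The other terms are polynomials in the radicands. -/
theorem Ht_param_zero (t : Fin 4 → ℝ) {q : ℂ × ℂ} (hq : q ∈ dom 0) : Ht t (param 0 q) =
    normPart t (‖q.1‖ ^ 2) (‖q.2‖ ^ 2) + t 0 * (1 / 50 * (crossCoeff q * q.2.re)) := by
  have h4 : ∀ k, ‖sec 0 q k‖ ^ 4 = radicand 0 k q ^ 2 := fun k => by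
    rw [← normSq_sec hq]
    ring
  have hr := congrFun (radicand_zero q)
  have r2 : radicand 0 2 q = 2 - ‖q.1‖ ^ 2 + ‖q.2‖ ^ 2 := hr 2
  have r3 : radicand 0 3 q = 6 - 2 * ‖q.1‖ ^ 2 + ‖q.2‖ ^ 2 := hr 3
  have r4 : radicand 0 4 q = 6 - ‖q.1‖ ^ 2 := hr 4
  have r6 : radicand 0 6 q = 4 + ‖q.1‖ ^ 2 - ‖q.2‖ ^ 2 := hr 6
  have hγ : (starRingEnd ℂ (sec 0 q 1 * sec 0 q 2 * sec 0 q 3) *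
      (sec 0 q 5 * sec 0 q 6 * sec 0 q 7)).re = crossCoeff q * q.2.re := by
    rw [show sec 0 q 1 = q.2 from sec_snd 0 q, sec_other (k := 2) (by decide),
      sec_other (k := 3) (by decide), sec_other (k := 5) (by decide),
      sec_other (k := 6) (by decide), sec_other (k := 7) (by decide), crossCoeff]
    simp
    ring
  rw [param_eq hq, Ht_proj]
  dsimp only
  rw [hγ, h4, h4, h4, normSq_sec hq, r2, r3, r4, r6, normPart]
  ring

/-- Rotating `b` fixes both moduli, hence `normPart`, `crossCoeff` and membership in the domain.
Only `Re b` varies, with derivative `-Im b`. -/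
theorem isRegular_of_im_ne_zero {t : Fin 4 → ℝ} (ht : t 0 ≠ 0) {a b : ℂ} (hq : (a, b) ∈ dom 0)
    (ha : a ≠ 0) (hb : b.im ≠ 0) : IsRegular J (Ht t) 0 (a, b) := by
  have hc : HasDerivAt (fun s : ℝ => Complex.exp (s * Complex.I) * b) (Complex.I * b) 0 := by
    refine (((Complex.ofRealCLM.hasDerivAt (x := (0 : ℝ))).mul_const
      Complex.I).cexp.mul_const b).congr_deriv ?_
    simp
  have hn : ∀ s : ℝ, ‖Complex.exp (s * Complex.I) * b‖ = ‖b‖ := fun s => by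
    rw [norm_mul, Complex.norm_exp_ofReal_mul_I, one_mul]
  have hH : (fun s : ℝ => Ht t (param 0 (a, Complex.exp (s * Complex.I) * b))) =
      fun s : ℝ => normPart t (‖a‖ ^ 2) (‖b‖ ^ 2) +
        t 0 * (1 / 50 * (crossCoeff (a, b) * (Complex.exp (s * Complex.I) * b).re)) := by
    funext s
    have hs : crossCoeff (a, Complex.exp (s * Complex.I) * b) = crossCoeff (a, b) := by
      have h := fun k => radicand_congr (q := (a, Complex.exp (s * Complex.I) * b)) (q' := (a, b))
        rfl (hn s) 0 k
      simp only [crossCoeff, h]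
    rw [Ht_param_zero t (mem_dom_congr (q := (a, b)) (q' := (a, Complex.exp (s * Complex.I) * b)) rfl (hn s).symm hq),
      hs]
    dsimp only
    rw [hn]
  have hre : HasDerivAt (fun s : ℝ => (Complex.exp (s * Complex.I) * b).re) (-b.im) 0 := by
    refine (Complex.reCLM.hasFDerivAt.comp_hasDerivAt (0 : ℝ) hc).congr_deriv ?_
    simp
  refine isRegular_zero (contMDiff_Ht t) hq ha hc (by simp) (hH ▸
    (((hre.const_mul (crossCoeff (a, b))).const_mul (1 / 50)).const_mul (t 0)).const_add _) ?_
  have := (crossCoeff_pos hq).ne'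
  simp [ht, hb, this]

/-- For `t 0 = 0`, the partial derivative of `normPart t` with respect to the second variable. -/
def slope (t : Fin 4 → ℝ) (x y : ℝ) : ℝ :=
  1 / 2 + t 1 * (1 / 25 * ((6 - x) ^ 2 * (6 - 2 * x + y))) +
    t 2 * (1 / 25 * ((6 - 2 * x + y) * (4 + x - y) * (3 * x - 2 - 2 * y))) -
    t 3 * (1 / 50 * ((6 - x) ^ 2 * (4 + x - y)))

theorem hasDerivAt_normPart {t : Fin 4 → ℝ} (ht : t 0 = 0) (x y : ℝ) :
    HasDerivAt (normPart t x) (slope t x y) y := by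
  have hy := hasDerivAt_id y
  have h3 := hy.const_add (6 - 2 * x)
  have h6 := hy.const_sub (4 + x)
  have h := ((((hy.const_add (2 - x)).div_const 2).const_mul (1 - 2 * t 0)).add
    ((((h3.pow 2).const_mul ((6 - x) ^ 2)).const_mul (1 / 50)).const_mul (t 1))).add
    ((((h3.pow 2).mul (h6.pow 2)).const_mul (1 / 50)).const_mul (t 2)) |>.add
    ((((h6.pow 2).const_mul ((6 - x) ^ 2)).const_mul (1 / 100)).const_mul (t 3))
  refine (h.congr_of_eventuallyEq (.of_forall fun y => ?_)).congr_deriv ?_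
  · simp [normPart]
  · simp [slope, ht]
    ring

/-- For `t 0 = 0` only moduli matter, so `b` is scaled by `1 + s`: then `|b|²` grows at the rate
`2|b|²`, and the chain rule multiplies this by `slope`. -/
theorem isRegular_of_slope_ne_zero {t : Fin 4 → ℝ} (ht : t 0 = 0) {a b : ℂ} (hq : (a, b) ∈ dom 0)
    (ha : a ≠ 0) (hb : b ≠ 0) (hs : slope t (‖a‖ ^ 2) (‖b‖ ^ 2) ≠ 0) :
    IsRegular J (Ht t) 0 (a, b) := by
  have hc : HasDerivAt (fun s : ℝ => (1 + s : ℂ) * b) b 0 := by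
    simpa using ((Complex.ofRealCLM.hasDerivAt (x := (0 : ℝ))).const_add 1).mul_const b
  have hy : HasDerivAt (fun s : ℝ => (1 + s) ^ 2 * ‖b‖ ^ 2) (2 * ‖b‖ ^ 2) 0 := by
    refine ((((hasDerivAt_id (0 : ℝ)).const_add 1).pow 2).mul_const (‖b‖ ^ 2)).congr_deriv ?_
    simp
  have hN := HasDerivAt.comp (h₂ := normPart t (‖a‖ ^ 2)) (0 : ℝ)
    (by simpa using hasDerivAt_normPart ht (‖a‖ ^ 2) (‖b‖ ^ 2)) hy
  refine isRegular_zero (contMDiff_Ht t) hq ha hc (by simp)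
    (hN.congr_of_eventuallyEq ?_) (mul_ne_zero hs (by simpa using hb))
  -- Unlike a rotation, scaling can leave the domain, so the chart formula is available only for
  -- small `s`.
  have hev : ∀ᶠ s : ℝ in nhds 0, (a, (1 + s : ℂ) * b) ∈ dom 0 := by
    refine (continuousAt_const.prodMk hc.continuousAt).eventually_mem ?_
    simpa using (isOpen_dom 0).mem_nhds hq
  filter_upwards [hev] with s hs
  rw [Ht_param_zero t hs, ht]
  have h1 : ‖(1 + s : ℂ) * b‖ ^ 2 = (1 + s) ^ 2 * ‖b‖ ^ 2 := by
    rw [norm_mul, mul_pow, ← sq_abs (1 + s), ← Real.norm_eq_abs, ← Complex.norm_real]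
    push_cast
    rfl
  simp only [Function.comp_apply, h1, zero_mul, add_zero]

/-! ### Null sets -/

instance : (MeasureTheory.volume : MeasureTheory.Measure (ℂ × ℂ)).IsAddHaarMeasure :=
  MeasureTheory.Measure.prod.instIsAddHaarMeasure _ _

theorem volume_fst_eq_zero : MeasureTheory.volume {q : ℂ × ℂ | q.1 = 0} = 0 := by
  have h : (LinearMap.fst ℝ ℂ ℂ).ker ≠ ⊤ := fun h => by
    have : ((1 : ℂ), (0 : ℂ)) ∈ (LinearMap.fst ℝ ℂ ℂ).ker := h ▸ Submodule.mem_top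
    simp at this
  exact MeasureTheory.Measure.addHaar_submodule MeasureTheory.volume _ h

theorem volume_snd_eq_zero : MeasureTheory.volume {q : ℂ × ℂ | q.2 = 0} = 0 := by
  have h : (LinearMap.snd ℝ ℂ ℂ).ker ≠ ⊤ := fun h => by
    have : ((0 : ℂ), (1 : ℂ)) ∈ (LinearMap.snd ℝ ℂ ℂ).ker := h ▸ Submodule.mem_top
    simp at this
  exact MeasureTheory.Measure.addHaar_submodule MeasureTheory.volume _ h

theorem volume_snd_im_eq_zero : MeasureTheory.volume {q : ℂ × ℂ | q.2.im = 0} = 0 := by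
  have h : (Complex.imLm ∘ₗ LinearMap.snd ℝ ℂ ℂ).ker ≠ ⊤ := fun h => by
    have : ((0 : ℂ), Complex.I) ∈ (Complex.imLm ∘ₗ LinearMap.snd ℝ ℂ ℂ).ker :=
      h ▸ Submodule.mem_top
    simp at this
  exact MeasureTheory.Measure.addHaar_submodule MeasureTheory.volume _ h

/-- The zero set lies in finitely many circles about the origin, with radii the square roots of the
roots of `P`. -/
theorem volume_eval_norm_sq_eq_zero {P : Polynomial ℝ} (hP : P ≠ 0) :
    MeasureTheory.volume {z : ℂ | P.eval (‖z‖ ^ 2) = 0} = 0 := by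
  refine MeasureTheory.measure_mono_null (t := ⋃ r ∈ P.roots.toFinset, Metric.sphere (0 : ℂ) √r)
    (fun z hz => ?_) ?_
  · simp only [Set.mem_iUnion]
    refine ⟨‖z‖ ^ 2, by simpa [hP] using hz, ?_⟩
    rw [mem_sphere_zero_iff_norm, Real.sqrt_sq (norm_nonneg z)]
  · exact (MeasureTheory.measure_biUnion_null_iff (Finset.countable_toSet _)).2 fun r _ =>
      MeasureTheory.Measure.addHaar_sphere _ _ _

open Polynomial in
theorem volume_slope_eq_zero (t : Fin 4 → ℝ) :
    MeasureTheory.volume {q : ℂ × ℂ | slope t (‖q.1‖ ^ 2) (‖q.2‖ ^ 2) = 0} = 0 := by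
  have hclosed : IsClosed {q : ℂ × ℂ | slope t (‖q.1‖ ^ 2) (‖q.2‖ ^ 2) = 0} := by
    refine isClosed_eq ?_ continuous_const
    unfold slope
    fun_prop
  -- Fubini: it suffices that for almost every `a` the slice in `b` is null.
  refine (MeasureTheory.Measure.measure_prod_null hclosed.measurableSet).2 ?_
  -- The restriction of `slope` to the line `y = (3x - 2)/2`. There the factor `3x - 2 - 2y` kills
  -- the `t 2` term, and both `6 - 2x + y` and `4 + x - y` equal `(10 - x)/2`.
  let P : ℝ[X] := C (1 / 2) + C ((2 * t 1 - t 3) / 100) * ((6 - X) ^ 2 * (10 - X))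
  -- At `x = 6` only the constant `1/2` survives, for every `t`.
  have hP : P ≠ 0 := fun h => by
    have := congrArg (eval 6) h
    simp [P] at this
  have hPs : ∀ x, P.eval x = slope t x ((3 * x - 2) / 2) := fun x => by
    simp [P, slope]
    ring
  have hae : ∀ᵐ a : ℂ, P.eval (‖a‖ ^ 2) ≠ 0 := by
    rw [MeasureTheory.ae_iff]
    simpa using volume_eval_norm_sq_eq_zero hP
  filter_upwards [hae] with a ha
  set x := ‖a‖ ^ 2
  -- `slope` as a polynomial in `y` for fixed `x`. If it were zero, so would be its value `P(x)` at
  -- `y = (3x - 2)/2`; that this `y` may be negative is harmless.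
  let Q : ℝ[X] := C (1 / 2) + C (t 1 * (1 / 25) * (6 - x) ^ 2) * (C (6 - 2 * x) + X) +
    C (t 2 * (1 / 25)) * ((C (6 - 2 * x) + X) * (C (4 + x) - X) *
      (C (3 * x - 2) - C 2 * X)) - C (t 3 * (1 / 50) * (6 - x) ^ 2) * (C (4 + x) - X)
  have hQs : ∀ y, Q.eval y = slope t x y := fun y => by
    simp only [Q, slope, eval_add, eval_sub, eval_mul, eval_C, eval_X]
    ring
  have hQ : Q ≠ 0 := fun h => ha (by rw [hPs, ← hQs, h, eval_zero])
  have h := volume_eval_norm_sq_eq_zero hQ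
  simp only [hQs] at h
  exact h

/-! ### From the chart `φ_0` to all of `M`. -/

/-- A property of the points of `M` holds almost everywhere if it does so in the chart `φ_0`. -/
theorem almostEverywhere_of_chart_zero {P : M → Prop} {N : Set (ℂ × ℂ)}
    (hN : MeasureTheory.volume N = 0) (h : ∀ q ∈ dom 0, q ∉ N → P ((chart 0).symm q)) :
    AlmostEverywhere P := by
  rintro _ ⟨ν, rfl⟩
  -- The part of `N` on which the transition map from `φ_0` to `φ_ν` is defined and differentiable,
  -- so that its image is again null.
  set S := N ∩ {q | q ∈ dom 0 ∧ ∀ k ∈ others ν, sec 0 q k ≠ 0}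
  have hd : DifferentiableOn ℝ (coord ν ∘ sec 0) S := fun q hq =>
    (((contDiffAt_coord hq.2.2).differentiableAt (by simp)).comp q
      ((contDiffAt_sec hq.2.1).differentiableAt (by simp))).differentiableWithinAt
  have hS := MeasureTheory.addHaar_image_eq_zero_of_differentiableOn_of_addHaar_eq_zero
    MeasureTheory.volume hd (MeasureTheory.measure_mono_null Set.inter_subset_left hN)
  refine MeasureTheory.measure_mono_null (t := {q | q.1 = 0} ∪ {q | q.2 = 0} ∪
    (coord ν ∘ sec 0) '' S) ?_ (MeasureTheory.measure_union_null
      (MeasureTheory.measure_union_null volume_fst_eq_zero volume_snd_eq_zero) hS)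
  rintro q ⟨hq, hP⟩
  have hq : q ∈ dom ν := hq
  by_cases h1 : q.1 = 0
  · exact Or.inl (Or.inl h1)
  by_cases h2 : q.2 = 0
  · exact Or.inl (Or.inr h2)
  right
  -- Off the two coordinate axes all eight coordinates are nonzero, so the point also lies in the
  -- domain of the chart `φ_0`.
  have hne : ∀ k, sec ν q k ≠ 0 := fun k => by
    by_cases hk : k ∈ others ν
    · exact sec_ne_zero hq hk
    · rw [mem_others, not_and_or, not_not, not_not] at hk
      rcases hk with rfl | rfl
      · rwa [sec_fst]
      · rwa [sec_snd]
  have hp0 : (chart ν).symm q ∈ (chart 0).source := (chart_symm_mem hq).2 fun k _ => hne k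
  have hq0 : chart 0 ((chart ν).symm q) ∈ dom 0 := (chart 0).map_source hp0
  have hinv := (chart 0).left_inv hp0
  have hpν : (chart ν).symm q ∈ (chart ν).source := (chart ν).map_target hq
  refine ⟨chart 0 ((chart ν).symm q), ⟨?_, hq0, ?_⟩, ?_⟩
  · by_contra hN'
    have := h _ hq0 hN'
    rw [hinv] at this
    exact hP this
  · rw [← chart_symm_mem hq0, hinv]
    exact hpν
  · rw [Function.comp_apply, ← chart_symm_trans hq0, hinv]
    exact (chart ν).right_inv hq

/-- The split at `t 0 = 0` decides which motion of `b` detects `dH_t`: scaling when `γ₁` is absent,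
rotation when it is present. -/
theorem exists_null_isRegular (t : Fin 4 → ℝ) : ∃ N : Set (ℂ × ℂ), MeasureTheory.volume N = 0 ∧
    ∀ q ∈ dom 0, q ∉ N → IsRegular J (Ht t) 0 q := by
  by_cases ht : t 0 = 0
  · refine ⟨{q | q.1 = 0} ∪ {q | q.2 = 0} ∪ {q | slope t (‖q.1‖ ^ 2) (‖q.2‖ ^ 2) = 0},
      MeasureTheory.measure_union_null (MeasureTheory.measure_union_null volume_fst_eq_zero
        volume_snd_eq_zero) (volume_slope_eq_zero t), fun q hq hN => ?_⟩
    simp only [Set.mem_union, Set.mem_ofPred_eq, not_or] at hN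
    exact isRegular_of_slope_ne_zero ht hq hN.1.1 hN.1.2 hN.2
  · refine ⟨{q | q.1 = 0} ∪ {q | q.2.im = 0}, MeasureTheory.measure_union_null volume_fst_eq_zero
      volume_snd_im_eq_zero, fun q hq hN => ?_⟩
    simp only [Set.mem_union, Set.mem_ofPred_eq, not_or] at hN
    exact isRegular_of_im_ne_zero ht hq hN.1 hN.2

end OctagonSystem

end

theorem mainTheorem4 (t : Fin 4 → ℝ) :
    OctagonSystem.AlmostEverywhere (fun p : OctagonSystem.M =>
      LinearIndependent ℝ
        ![OctagonSystem.hamVF OctagonSystem.reducedForm OctagonSystem.J p,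
          OctagonSystem.hamVF OctagonSystem.reducedForm (OctagonSystem.Ht t) p]) ∧
    OctagonSystem.IsCompletelyIntegrable OctagonSystem.reducedForm
      OctagonSystem.J (OctagonSystem.Ht t) := by
  have hJ := OctagonSystem.contMDiff_J
  have hH := OctagonSystem.contMDiff_Ht t
  -- One exceptional set serves both almost-everywhere claims, since regularity gives both
  -- independence and rank two.
  obtain ⟨N, hN, h⟩ := OctagonSystem.exists_null_isRegular t
  exact ⟨OctagonSystem.almostEverywhere_of_chart_zero hN fun q hq hqN =>
      (h q hq hqN).linearIndependent hJ hH hq,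
    { symplectic := OctagonSystem.isSymplectic_reducedForm
      smooth := hJ.prodMk_space hH
      rank_eq_two := OctagonSystem.almostEverywhere_of_chart_zero hN fun q hq hqN =>
        (h q hq hqN).finrank_range hJ hH hq
      commute := OctagonSystem.poissonBracket_J_Ht t }⟩
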